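/- Let $n\ge 2$, let $\mathcal H_i=\mathbb C^{d_i}$ ($1\le i\le n$) and $\mathcal H'_k=\mathbb C^{d'_k}$ ($1\le k\le n'$) be nonzero finite-dimensional Hilbert spaces, and let $\bar M$ denote the entrywise complex conjugate of $M$ in the product basis of $\bigotimes_i\mathcal H_i$. An *encoding* is a map $\mathcal E:\mathcal B(\bigotimes_{i=1}^n\mathcal H_i)\to\mathcal B(\bigotimes_{k=1}^{n'}\mathcal H'_k)$ with $\mathcal E(\mathbb 1)=\mathbb 1$, $\mathcal E(A^\dagger)=\mathcal E(A)^\dagger$, $\mathcal E(A+B)=\mathcal E(A)+\mathcal E(B)$, $\mathcal E(AB)=\mathcal E(A)\mathcal E(B)$ and $\mathcal E(xA)=x\,\mathcal E(A)$ for all operators $A,B$ and all $x\in\mathbb R$. It is *local* with respect to subsets $S'_1,\dots,S'_n\subseteq\{1,\dots,n'\}$ if for all $i$ and all $A\in\mathcal B(\mathcal H_i)$ the operator $\mathcal E(A\otimes\mathbb 1)$ acts as the identity on all sites outside $S'_i$, that is, has the form $Y\otimes\mathbb 1$ with $Y$ acting on the sites in $S'_i$. Let $\mathcal E$ be a local encoding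 with respect to $\{S'_i\}$. Put $Q_0=\bigcup_{i\ne j}(S'_i\cap S'_j)$ and $Q_i=S'_i\setminus Q_0$, and write $\mathcal H_Q=\bigotimes_{k\in Q}\mathcal H'_k$. Then: (1) There exist identifications $\mathcal H_i\simeq\mathcal H_i^{\rm (in)}\otimes\mathcal H_i^{\rm (out)}$, $\mathcal H_{Q_i}\simeq E_i\otimes\mathcal H_i^{\rm (out)}$ and $\mathcal H_{Q_0}\simeq E_0\otimes\bigotimes_i\mathcal H_i^{\rm (in)}$, where $E_0=\bigoplus_\alpha\bigotimes_{i=0}^nE_{0.i}^{(\alpha)}$ (a finite direct sum), all given by bijections between orthonormal product bases; a unitary $U_{Q_0}$ on $\mathcal H_{Q_0}$; unitaries $U_{(i)}^{(\alpha)}$ on $\mathcal H_i\otimes E_i\otimes E_{0.i}^{(\alpha)}$ for $1\le i\le n$ and all $\alpha$; and for each $\alpha$ a choice, the same for all operators $M$ (and hence for all sites), of $M^{(\alpha)}=M$ or $M^{(\alpha)}=\bar M$; such that for all operators $M$ $$\mathcal E(M)=U_{Q_0}\ \bigoplus_\alpha\Bigl(\Bigl[\bigotimes_{i=1}^nU_{(i)}^{(\alpha)}\Bigr]\bigl(M^{(\alpha)}\otimes\mathbb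 1_{E_1,\dots,E_n}\otimes\mathbb 1_{E_{0.1}^{(\alpha)},\dots,E_{0.n}^{(\alpha)}}\bigr)\Bigl[\bigotimes_{i=1}^nU_{(i)}^{(\alpha)}\Bigr]^\dagger\Bigr)\ U_{Q_0}^\dagger .$$ Here every operator is extended by the identity to the factors on which it is not written, in particular to $E_{0.0}^{(\alpha)}$ and to the sites that lie in no $S'_i$. (2) The locality structure is fixed by the images of 1-local operators: if $T\subseteq\{1,\dots,n\}$ is nonempty and $M$ acts non-trivially only on $T$, then $\mathcal E(M)$ acts non-trivially only on $\bigcup_{i\in T}S'_i$; and every encoding that agrees with $\mathcal E$ on all operators $A\otimes\mathbb 1$, $A\in\mathcal B(\mathcal H_i)$, $1\le i\le n$, equals $\mathcal E$. -/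

import Mathlib

open scoped Kronecker

namespace LocalEnc

/-- Labels of the product basis of `⨂ i, ℂ^(d i)`. -/
abbrev Cfg {ι : Type*} (d : ι → ℕ) : Type _ := ∀ i, Fin (d i)

/-- Operators on `⨂ i, ℂ^(d i)`, as matrices in the product basis. -/
abbrev Op {ι : Type*} (d : ι → ℕ) : Type _ := Matrix (Cfg d) (Cfg d) ℂ

/-- The tensor product `⨂ i, A i` of a finite family of operators. -/
def tensorOp {ι : Type*} [Fintype ι] {κ : ι → Type*} (A : ∀ i, Matrix (κ i) (κ i) ℂ) :
    Matrix (∀ i, κ i) (∀ i, κ i) ℂ :=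
  fun x y => ∏ i, A i (x i) (y i)

/-- The 1-local operator `A ⊗ 1`, with `A` acting on site `i`. -/
def onSite {n : ℕ} {d : Fin n → ℕ} (i : Fin n) (A : Matrix (Fin (d i)) (Fin (d i)) ℂ) : Op d :=
  tensorOp (Function.update (fun j => (1 : Matrix (Fin (d j)) (Fin (d j)) ℂ)) i A)

/-- Restriction of a label to the sites in `S`. -/
def res {ι : Type*} {d : ι → ℕ} (S : Finset ι) (x : Cfg d) : Cfg (fun j : S => d j) :=
  fun j => x j

/-- `Y ⊗ 1`, where `Y` acts on the sites in `S` and the identity acts on all other sites. -/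
def extendOp {ι : Type*} [Fintype ι] [DecidableEq ι] {d : ι → ℕ} (S : Finset ι)
    (Y : Op (fun j : S => d j)) : Op d :=
  (Y ⊗ₖ (1 : Op (fun j : (Sᶜ : Finset ι) => d j))).submatrix
    (fun x => (res S x, res Sᶜ x)) (fun x => (res S x, res Sᶜ x))

/-- `X` acts non-trivially only on the sites in `S`. -/
def ActsOnlyOn {ι : Type*} [Fintype ι] [DecidableEq ι] {d : ι → ℕ} (S : Finset ι) (X : Op d) :
    Prop :=
  ∃ Y : Op (fun j : S => d j), X = extendOp S Y

/-- Entrywise complex conjugation (no transposition). -/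
def conjOp {κ : Type*} (M : Matrix κ κ ℂ) : Matrix κ κ ℂ := M.map (starRingEnd ℂ)

/-- Encodings, as maps on all matrices. -/
structure IsEncoding {κ κ' : Type*} [Fintype κ] [DecidableEq κ] [Fintype κ'] [DecidableEq κ']
    (E : Matrix κ κ ℂ → Matrix κ' κ' ℂ) : Prop where
  map_one : E 1 = 1
  map_conjTranspose : ∀ A, E A.conjTranspose = (E A).conjTranspose
  map_add : ∀ A B, E (A + B) = E A + E B
  map_mul : ∀ A B, E (A * B) = E A * E B
  map_real_smul : ∀ (x : ℝ) A, E (x • A) = x • E A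

/-- Encodings that are local with respect to subsets `S i` of the simulator sites. -/
structure IsLocalEncoding {n n' : ℕ} {d : Fin n → ℕ} {d' : Fin n' → ℕ}
    (S : Fin n → Finset (Fin n')) (E : Op d → Op d') : Prop where
  isEncoding : IsEncoding E
  actsOnlyOn : ∀ (i : Fin n) (A : Matrix (Fin (d i)) (Fin (d i)) ℂ),
    ActsOnlyOn (S i) (E (onSite i A))

/-- The overlap region `Q₀`, the union of all `S i ∩ S j` with `i ≠ j`. -/
def overlap {n n' : ℕ} (S : Fin n → Finset (Fin n')) : Finset (Fin n') :=
  {k | ∃ i j, i ≠ j ∧ k ∈ S i ∩ S j}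

/-- The private region `Q i = S i \ Q₀`. -/
def priv {n n' : ℕ} (S : Fin n → Finset (Fin n')) (i : Fin n) : Finset (Fin n') :=
  S i \ overlap S

/-- The simulator sites that lie in none of the `S i`. -/
def outside {n n' : ℕ} (S : Fin n → Finset (Fin n')) : Finset (Fin n') :=
  (Finset.univ.biUnion S)ᶜ

/-- Decompositions of the spaces involved. A space of dimension `k` is `ℂ^k`, and an identification
of spaces is a bijection between orthonormal bases; the basis of a tensor product is the product
of the bases, and that of a direct sum is their disjoint union. -/
structure Decomposition {n n' : ℕ} (d : Fin n → ℕ) (d' : Fin n' → ℕ)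
    (S : Fin n → Finset (Fin n')) where
  /-- the number of blocks `α` -/
  r : ℕ
  /-- dimension of the factor `H_i^in` of `H_i` -/
  dIn : Fin n → ℕ
  /-- dimension of the factor `H_i^out` of `H_i` -/
  dOut : Fin n → ℕ
  /-- dimension of `E_i` -/
  dE : Fin n → ℕ
  /-- dimension of `E_{0.0}^α` -/
  dE00 : Fin r → ℕ
  /-- dimension of `E_{0.i}^α` for the sites `i` of the original system -/
  dE0 : Fin r → Fin n → ℕ
  /-- `H_i ≃ H_i^in ⊗ H_i^out` -/
  site : ∀ i, Fin (d i) ≃ Fin (dIn i) × Fin (dOut i)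
  /-- `H_{Q₀} ≃ E_0 ⊗ (⨂ i, H_i^in)`, where `E_0 = ⨁ α, E_{0.0}^α ⊗ (⨂ i, E_{0.i}^α)` -/
  overlapEquiv : Cfg (fun k : overlap S => d' k) ≃
    (Σ α : Fin r, Fin (dE00 α) × (∀ i, Fin (dE0 α i))) × (∀ i, Fin (dIn i))
  /-- `H_{Q_i} ≃ E_i ⊗ H_i^out` -/
  privEquiv : ∀ i, Cfg (fun k : priv S i => d' k) ≃ Fin (dE i) × Fin (dOut i)

namespace Decomposition

variable {n n' : ℕ} {d : Fin n → ℕ} {d' : Fin n' → ℕ} {S : Fin n → Finset (Fin n')}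

/-- Basis labels of `H_i ⊗ E_i ⊗ E_{0.i}^α`. -/
abbrev Loc (D : Decomposition d d' S) (α : Fin D.r) (i : Fin n) : Type :=
  Fin (d i) × (Fin (D.dE i) × Fin (D.dE0 α i))

/-- Basis labels of block `α` of the simulator space: `E_{0.0}^α`, times all
`H_i ⊗ E_i ⊗ E_{0.i}^α`, times the simulator sites outside all `S i`. -/
abbrev Blk (D : Decomposition d d' S) (α : Fin D.r) : Type :=
  Fin (D.dE00 α) × ((∀ i, D.Loc α i) × Cfg (fun k : outside S => d' k))

/-- The identification of the simulator space with the direct sum of the blocks, obtained from the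
given identifications of `H_{Q₀}`, `H_{Q_i}` and `H_i` by regrouping tensor factors. -/
def regroup (D : Decomposition d d' S) (x : Cfg d') : Σ α : Fin D.r, D.Blk α :=
  let q := D.overlapEquiv (res (overlap S) x)
  let p := fun i => D.privEquiv i (res (priv S i) x)
  ⟨q.1.1, q.1.2.1,
    fun i => ((D.site i).symm (q.2 i, (p i).2), ((p i).1, q.1.2.2 i)), res (outside S) x⟩

/-- `M ⊗ 1` on `⨂ i, (H_i ⊗ E_i ⊗ E_{0.i}^α)`, with `M` acting on `⨂ i, H_i`. -/
def ampl (D : Decomposition d d' S) (α : Fin D.r) (M : Op d) :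
    Matrix (∀ i, D.Loc α i) (∀ i, D.Loc α i) ℂ :=
  (M ⊗ₖ (1 : Matrix (∀ i, Fin (D.dE i) × Fin (D.dE0 α i))
      (∀ i, Fin (D.dE i) × Fin (D.dE0 α i)) ℂ)).submatrix
    (fun x => (fun i => (x i).1, fun i => (x i).2)) (fun x => (fun i => (x i).1, fun i => (x i).2))

/-- The operator `[⨂ i, U i] (M ⊗ 1) [⨂ i, U i]†` on block `α`, extended by the identity to
`E_{0.0}^α` and to the simulator sites outside all `S i`. -/
def block (D : Decomposition d d' S) (α : Fin D.r)
    (U : ∀ i, Matrix (D.Loc α i) (D.Loc α i) ℂ) (M : Op d) : Matrix (D.Blk α) (D.Blk α) ℂ :=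
  (1 : Matrix (Fin (D.dE00 α)) (Fin (D.dE00 α)) ℂ) ⊗ₖ
    ((tensorOp U * D.ampl α M * (tensorOp U).conjTranspose) ⊗ₖ
      (1 : Op (fun k : outside S => d' k)))

/-- The operator `⨁ α, B α` on the simulator space. -/
def directSum (D : Decomposition d d' S) (B : ∀ α, Matrix (D.Blk α) (D.Blk α) ℂ) : Op d' :=
  (Matrix.blockDiagonal' B).submatrix D.regroup D.regroup

end Decomposition

end LocalEnc

/-!
A local encoding is determined by its values on 1-local operators, since these generate all operators
under sums and products (`ActsOnlyOn.induction`, `IsEncoding.eq_of_onSite`); scalars are 1-local, so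
real-linearity suffices. The same induction gives the support of `E M`. It remains to construct a
block form that has the right values on 1-local operators.

Since `E (A ⊗ 1)` lives on `S i = Q_i ∪ (S i ∩ Q₀)`, it is an operator on `H_{Q_i} ⊗ H_{Q₀}`. Its
matrix entries with respect to the basis of `H_{Q_i}` are operators on `H_{Q₀}` (`slice`), and they
form a set that is closed under adjoints. As distinct `Q_i` are disjoint, the sets that belong to
distinct sites commute (`slice_commute`). For one such set, the space splits orthogonally into
isotypic components `ℂ^k ⊗ ℂ^l` with the set acting on the first factor and its commutant on the
second (`exists_isotypic_decomposition`, by Schur's lemma); applying this to one site after another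
splits `H_{Q₀}` into blocks `ℂ^l ⊗ ⨂ i, ℂ^(k i)` such that site `i` acts on the factor `ℂ^(k i)` only
(`exists_joint_decomposition`).

The image `J` of the imaginary unit is 1-local on every site. As there are at least two sites, it
acts on `H_{Q₀}` only, and on each block it acts both on one factor and on another one, so it is a
scalar there, equal to `i` or `-i`. On each block, the encoding of site `i` thus restricts to a
representation on `H_{Q_i} ⊗ ℂ^(k i)` which is complex linear or becomes so after complex
conjugation, with the same alternative for all sites, and such a representation is an amplification
`A ↦ A ⊗ 1` up to a unitary (`IsEncoding.exists_unitary_of_map_I`, `exists_normal_form`).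

Comparing dimensions, `dim H_{Q_i} * k i` is a multiple of `d i` on every block. Let `H_i^out` have
dimension `gcd (d i) (dim H_{Q_i})`; then the dimension of `H_i^in` divides `k i` on every block, so
that the factor `H_i^in` can be split off all blocks at once (`exists_dimensions`).
-/

namespace LocalEnc

open scoped Matrix

/-! ### Isometries and invariant subspaces in matrix form -/

/-- The kernel of `A` is the range of an isometry `V`; every matrix whose columns lie in the kernel
is fixed by the projection `V * Vᴴ`. -/
theorem exists_isometry_ker {M N : Type} [Fintype M] [Fintype N] [DecidableEq N]
    (A : Matrix M N ℂ) :
    ∃ (m : ℕ) (V : Matrix N (Fin m) ℂ), Vᴴ * V = 1 ∧ A * V = 0 ∧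
      ∀ {p : Type} (B : Matrix N p ℂ), A * B = 0 → V * (Vᴴ * B) = B := by
  classical
  let K : Submodule ℂ (EuclideanSpace ℂ N) :=
    (LinearMap.ker A.mulVecLin).comap (WithLp.linearEquiv 2 ℂ (N → ℂ)).toLinearMap
  let b := stdOrthonormalBasis ℂ K
  let V : Matrix N (Fin (Module.finrank ℂ K)) ℂ := Matrix.of fun x j => (b j : EuclideanSpace ℂ N) x
  have hVV : ∀ w : EuclideanSpace ℂ N, ∀ j,
      inner ℂ (b j : EuclideanSpace ℂ N) w = ∑ x, star (V x j) * w x := by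
    intro w j
    rw [PiLp.inner_apply]
    exact Finset.sum_congr rfl fun x _ => by simp [V, mul_comm]
  refine ⟨_, V, ?_, ?_, ?_⟩
  · ext i j
    have := orthonormal_iff_ite.1 b.orthonormal i j
    rw [Submodule.coe_inner, hVV] at this
    simpa [Matrix.mul_apply, Matrix.one_apply, V] using this
  · ext i j
    have : A.mulVec (fun x => (b j : EuclideanSpace ℂ N) x) = 0 := (b j).2
    simpa [Matrix.mul_apply, Matrix.mulVec, dotProduct, V] using congrFun this i
  · intro p B hB
    ext x q
    let w : K := ⟨WithLp.toLp 2 (fun y => B y q), by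
      change A.mulVec (fun y => B y q) = 0
      ext i
      simpa [Matrix.mul_apply, Matrix.mulVec, dotProduct] using congrFun (congrFun hB i) q⟩
    have h := congrArg (fun v : K => (v : EuclideanSpace ℂ N) x) (b.sum_repr w)
    simp only [Submodule.coe_sum, Submodule.coe_smul, WithLp.ofLp_sum, Finset.sum_apply,
      WithLp.ofLp_smul, Pi.smul_apply, smul_eq_mul, b.repr_apply_apply, Submodule.coe_inner,
      hVV] at h
    rw [Matrix.mul_apply]
    refine Eq.trans (Finset.sum_congr rfl fun j _ => ?_) h
    simp only [Matrix.mul_apply, Matrix.conjTranspose_apply, w]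
    rw [mul_comm]; rfl

theorem card_add_card_eq {N p q : Type} [Fintype N] [DecidableEq N] [Fintype p] [DecidableEq p]
    [Fintype q] [DecidableEq q] {F : Matrix N p ℂ} {G : Matrix N q ℂ}
    (hF : Fᴴ * F = 1) (hG : Gᴴ * G = 1)
    (hFG : F * Fᴴ + G * Gᴴ = 1) :
    Fintype.card p + Fintype.card q = Fintype.card N := by
  have h := congrArg Matrix.trace hFG
  rw [Matrix.trace_add, Matrix.trace_mul_comm, hF, Matrix.trace_mul_comm, hG] at h
  simp only [Matrix.trace_one] at h
  exact_mod_cast h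

/-- The orthogonal complement of the range of an isometry is the range of an isometry. -/
theorem exists_complement {N p : Type} [Fintype N] [DecidableEq N] [Fintype p] [DecidableEq p]
    {F : Matrix N p ℂ} (hF : Fᴴ * F = 1) :
    ∃ (m : ℕ) (G : Matrix N (Fin m) ℂ), Gᴴ * G = 1 ∧ Fᴴ * G = 0 ∧
      F * Fᴴ + G * Gᴴ = 1 := by
  obtain ⟨m, G, h1, h2, h3⟩ := exists_isometry_ker Fᴴ
  refine ⟨m, G, h1, h2, ?_⟩
  have h4 := h3 (1 - F * Fᴴ) (by rw [Matrix.mul_sub, ← Matrix.mul_assoc, hF]; simp)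
  have h5 : Gᴴ * F = 0 := by
    have := congrArg Matrix.conjTranspose h2
    simpa using this
  rw [Matrix.mul_sub, ← Matrix.mul_assoc (Gᴴ), h5] at h4
  simp only [Matrix.mul_one, Matrix.zero_mul, sub_zero] at h4
  rw [h4]; abel

theorem card_le_of_isometry {N p : Type} [Fintype N] [DecidableEq N] [Fintype p] [DecidableEq p]
    {F : Matrix N p ℂ} (hF : Fᴴ * F = 1) : Fintype.card p ≤ Fintype.card N := by
  obtain ⟨m, G, h1, h2, h3⟩ := exists_complement hF
  have := card_add_card_eq hF h1 h3
  omega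

/-- An isometry `W` onto a nonzero subspace of minimal dimension that is invariant under `S`, with
Schur's lemma: operators commuting with the action of `S` on it are scalars, because their
eigenspaces give smaller invariant subspaces. -/
theorem exists_minimal_invariant {N : Type} [Fintype N] [DecidableEq N] [Nonempty N]
    (S : Set (Matrix N N ℂ)) :
    ∃ (k : ℕ) (W : Matrix N (Fin k) ℂ), 0 < k ∧ Wᴴ * W = 1 ∧
      (∀ s ∈ S, s * W = W * (Wᴴ * s * W)) ∧
      ∀ Z : Matrix (Fin k) (Fin k) ℂ, (∀ s ∈ S, Commute (Wᴴ * s * W) Z) →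
        ∃ c : ℂ, Z = c • 1 := by
  classical
  let Q : ℕ → Prop := fun k => 0 < k ∧ ∃ W : Matrix N (Fin k) ℂ, Wᴴ * W = 1 ∧
      ∀ s ∈ S, s * W = W * (Wᴴ * s * W)
  have hex : ∃ k, Q k := by
    let e := (Fintype.equivFin N).symm
    refine ⟨Fintype.card N, Fintype.card_pos, (1 : Matrix N N ℂ).submatrix id e, ?_, fun s _ => ?_⟩
    · rw [Matrix.conjTranspose_submatrix, ← Matrix.submatrix_mul _ _ _ id _ Function.bijective_id]
      simp
    · simp only [Matrix.conjTranspose_submatrix, Matrix.conjTranspose_one]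
      rw [← Matrix.mul_assoc, ← Matrix.mul_assoc, Matrix.submatrix_mul_equiv]
      simp
  obtain ⟨hk, W, hW, hinv⟩ := Nat.find_spec hex
  refine ⟨Nat.find hex, W, hk, hW, hinv, fun Z hZ => ?_⟩
  have : Nonempty (Fin (Nat.find hex)) := ⟨⟨0, hk⟩⟩
  obtain ⟨c, hc⟩ := Module.End.exists_eigenvalue (Matrix.toLin' Z)
  obtain ⟨v, hv⟩ := hc.exists_hasEigenvector
  obtain ⟨m, V, hV, hZV, hmax⟩ := exists_isometry_ker (Z - c • 1)
  have hm : 0 < m := by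
    rcases Nat.eq_zero_or_pos m with rfl | h
    · exfalso
      have h1 : (Z - c • 1) * (Matrix.of fun x (_ : Unit) => v x) = 0 := by
        have h2 := hv.apply_eq_smul
        rw [Matrix.toLin'_apply] at h2
        ext i j
        have := congrFun h2 i
        rw [Matrix.sub_mul, Matrix.smul_mul, Matrix.one_mul]
        simp only [Matrix.sub_apply, Matrix.mul_apply, Matrix.of_apply, Matrix.smul_apply,
          Matrix.zero_apply]
        simpa [Matrix.mulVec, dotProduct, sub_eq_zero] using this
      have h2 := hmax _ h1
      apply hv.2
      ext x
      have := congrFun (congrFun h2 x) ()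
      simpa [Matrix.mul_apply] using this.symm
    · exact h
  have hcomm : ∀ s ∈ S, (Wᴴ * s * W) * V =
      V * (Vᴴ * ((Wᴴ * s * W) * V)) := by
    intro s hs
    refine (hmax _ ?_).symm
    rw [← Matrix.mul_assoc, Matrix.sub_mul, ← (hZ s hs).eq, Matrix.smul_mul, Matrix.one_mul,
      Matrix.sub_mul]
    have : Z * V = c • V := by
      rw [Matrix.sub_mul, Matrix.smul_mul, Matrix.one_mul, sub_eq_zero] at hZV
      exact hZV
    rw [Matrix.mul_assoc, this]; simp
  have hQ : Q m := by
    refine ⟨hm, W * V, ?_, fun s hs => ?_⟩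
    · rw [Matrix.conjTranspose_mul, Matrix.mul_assoc, ← Matrix.mul_assoc _ W V, hW, Matrix.one_mul, hV]
    · calc s * (W * V) = W * ((Wᴴ * s * W) * V) := by
            rw [← Matrix.mul_assoc, hinv s hs, Matrix.mul_assoc]
        _ = _ := by
            rw [hcomm s hs]
            simp only [Matrix.conjTranspose_mul, Matrix.mul_assoc]
  have hle := Nat.find_min' hex hQ
  obtain ⟨m', G, hG, _, hVG⟩ := exists_complement hV
  have hcard := card_add_card_eq hV hG hVG
  simp only [Fintype.card_fin] at hcard
  have hm' : m' = 0 := by omega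
  subst hm'
  have hVV : V * Vᴴ = 1 := by
    rw [← hVG]
    have : V * Vᴴ + G * Gᴴ = V * Vᴴ := by ext; simp [Matrix.mul_apply]
    exact this.symm
  refine ⟨c, ?_⟩
  have := congrArg (· * Vᴴ) hZV
  simp only [Matrix.mul_assoc, hVV, Matrix.zero_mul, Matrix.mul_one] at this
  exact sub_eq_zero.1 this

open ComplexOrder in
/-- A nonzero multiple of an isometry can be normalised to an isometry. -/
theorem exists_smul_isometry {N K : Type} [Fintype N] [Fintype K] [DecidableEq K] [Nonempty K]
    {R : Matrix N K ℂ} {c : ℂ} (hR : Rᴴ * R = c • 1) (h0 : R ≠ 0) :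
    ∃ a : ℂ, (a • R)ᴴ * (a • R) = 1 := by
  let j : K := Classical.arbitrary K
  have hc : c = ((∑ x, Complex.normSq (R x j) : ℝ) : ℂ) := by
    have := congrFun (congrFun hR j) j
    simp only [Matrix.mul_apply, Matrix.conjTranspose_apply, Matrix.smul_apply,
      Matrix.one_apply_eq, smul_eq_mul, mul_one] at this
    rw [← this]
    push_cast
    exact Finset.sum_congr rfl fun x _ => by rw [Complex.normSq_eq_conj_mul_self]; rfl
  have hr : 0 ≤ ∑ x, Complex.normSq (R x j) := Finset.sum_nonneg fun x _ => Complex.normSq_nonneg _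
  set r := ∑ x, Complex.normSq (R x j)
  have hr0 : r ≠ 0 := by
    intro h
    rw [hc, h] at hR
    exact h0 (Matrix.conjTranspose_mul_self_eq_zero.1 (by simpa using hR))
  refine ⟨((Real.sqrt r)⁻¹ : ℝ), ?_⟩
  rw [Matrix.conjTranspose_smul, Matrix.smul_mul, Matrix.mul_smul, hR, hc, smul_smul, smul_smul,
    Complex.star_def, Complex.conj_ofReal, ← Complex.ofReal_mul, ← Complex.ofReal_mul]
  have : (Real.sqrt r)⁻¹ * (Real.sqrt r)⁻¹ * r = 1 := by
    rw [← mul_inv, Real.mul_self_sqrt hr, inv_mul_cancel₀ hr0]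
  rw [this]; simp

/-- A maximal orthonormal family of copies of one irreducible representation of a star-closed
set `S`; by maximality and Schur's lemma the commutant of `S` only mixes the copies. -/
theorem exists_isotypic_family {N : Type} [Fintype N] [DecidableEq N] [Nonempty N]
    (S : Set (Matrix N N ℂ)) (hS : ∀ s ∈ S, sᴴ ∈ S) :
    ∃ (k l : ℕ) (X : Matrix N N ℂ → Matrix (Fin k) (Fin k) ℂ) (F : Fin l → Matrix N (Fin k) ℂ),
      0 < k ∧ 0 < l ∧ (∀ i j, (F i)ᴴ * F j = if i = j then 1 else 0) ∧
      (∀ s ∈ S, ∀ j, s * F j = F j * X s) ∧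
      ∀ t, (∀ s ∈ S, Commute s t) → ∃ Y : Matrix (Fin l) (Fin l) ℂ,
        ∀ j, t * F j = ∑ i, Y i j • F i := by
  classical
  obtain ⟨k, W, hk, hW, hinv, schur⟩ := exists_minimal_invariant S
  have : Nonempty (Fin k) := ⟨⟨0, hk⟩⟩
  let X : Matrix N N ℂ → Matrix (Fin k) (Fin k) ℂ := fun s => Wᴴ * s * W
  have hX : ∀ s, (X s)ᴴ = X sᴴ := fun s => by
    simp [X, Matrix.conjTranspose_mul, Matrix.mul_assoc]
  -- a family of `l` mutually orthogonal copies of the representation `X`; `l` is chosen maximal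
  let P : ℕ → Prop := fun l => ∃ F : Fin l → Matrix N (Fin k) ℂ,
    (∀ i j, (F i)ᴴ * F j = if i = j then 1 else 0) ∧ ∀ s ∈ S, ∀ j, s * F j = F j * X s
  have hP1 : P 1 := ⟨fun _ => W, fun i j => by rw [if_pos (Subsingleton.elim i j), hW],
    fun s hs _ => hinv s hs⟩
  have hPle : ∀ l, P l → l ≤ Fintype.card N := by
    rintro l ⟨F, hF, -⟩
    let V : Matrix N (Fin l) ℂ := Matrix.of fun x j => F j x ⟨0, hk⟩
    have hV : Vᴴ * V = 1 := by
      ext i j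
      have := congrFun (congrFun (hF i j) ⟨0, hk⟩) ⟨0, hk⟩
      rw [Matrix.mul_apply] at this ⊢
      refine Eq.trans this ?_
      rw [Matrix.one_apply]
      split_ifs <;> simp
    simpa using card_le_of_isometry hV
  obtain ⟨F, hF, hSF⟩ := Nat.findGreatest_spec (P := P) (hPle 1 hP1) hP1
  have hl : 1 ≤ Nat.findGreatest P (Fintype.card N) := Nat.le_findGreatest (hPle 1 hP1) hP1
  have hmax : ¬ P (Nat.findGreatest P (Fintype.card N) + 1) := fun h => by
    have := Nat.le_findGreatest (hPle _ h) h
    omega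
  generalize Nat.findGreatest P (Fintype.card N) = l at F hF hSF hl hmax
  refine ⟨k, l, X, F, hk, hl, hF, hSF, fun t ht => ?_⟩
  have hFS : ∀ s ∈ S, ∀ j, X s * (F j)ᴴ = (F j)ᴴ * s := by
    intro s hs j
    have := congrArg Matrix.conjTranspose (hSF _ (hS s hs) j)
    simpa [Matrix.conjTranspose_mul, hX] using this.symm
  have hY : ∀ i j, ∃ c : ℂ, (F i)ᴴ * t * F j = c • 1 := by
    refine fun i j => schur _ fun s hs => ?_
    change X s * _ = _ * X s
    rw [← Matrix.mul_assoc, ← Matrix.mul_assoc, hFS s hs, Matrix.mul_assoc _ s t, (ht s hs).eq,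
      Matrix.mul_assoc _ (F j), ← hSF s hs]
    simp only [Matrix.mul_assoc]
  choose Y hY using hY
  refine ⟨Matrix.of Y, fun j => ?_⟩
  by_contra hne
  -- otherwise the component of `t * F j` orthogonal to all copies is a multiple of a further copy
  let R : Matrix N (Fin k) ℂ := t * F j - ∑ i, Y i j • F i
  have hR0 : R ≠ 0 := sub_ne_zero.2 hne
  have hFR : ∀ i, (F i)ᴴ * R = 0 := by
    intro i
    simp only [R, Matrix.mul_sub, Matrix.mul_sum, Matrix.mul_smul, hF, ← Matrix.mul_assoc, hY]
    simp
  have hSR : ∀ s ∈ S, s * R = R * X s := by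
    intro s hs
    simp only [R, Matrix.mul_sub, Matrix.sub_mul, Matrix.mul_sum, Matrix.sum_mul, Matrix.mul_smul,
      Matrix.smul_mul, hSF s hs]
    rw [← Matrix.mul_assoc, (ht s hs).eq, Matrix.mul_assoc, hSF s hs, Matrix.mul_assoc]
  have hRS : ∀ s ∈ S, X s * Rᴴ = Rᴴ * s := by
    intro s hs
    have := congrArg Matrix.conjTranspose (hSR _ (hS s hs))
    simpa [Matrix.conjTranspose_mul, hX] using this.symm
  obtain ⟨c, hc⟩ := schur (Rᴴ * R) fun s hs => by
    change X s * _ = _ * X s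
    rw [← Matrix.mul_assoc, hRS s hs, Matrix.mul_assoc, hSR s hs, Matrix.mul_assoc]
  obtain ⟨a, ha⟩ := exists_smul_isometry hc hR0
  have hRF : ∀ i, Rᴴ * F i = 0 := fun i => by
    simpa using congrArg Matrix.conjTranspose (hFR i)
  refine hmax ⟨Fin.snoc F (a • R), fun p q => ?_, fun s hs p => ?_⟩
  · induction p using Fin.lastCases with
    | last =>
      induction q using Fin.lastCases with
      | last => simpa using ha
      | cast q => simp [hRF, (Fin.castSucc_lt_last q).ne']
    | cast p =>
      induction q using Fin.lastCases with
      | last => simp [hFR, (Fin.castSucc_lt_last p).ne]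
      | cast q => simp [hF]
  · induction p using Fin.lastCases with
    | last => simp [hSR s hs]
    | cast p => simp [hSF s hs]

/-- A decomposition of the space with basis `N` as an orthogonal direct sum: isometries whose
range projections are mutually orthogonal and sum to the identity. -/
structure IsOrthoSum {ι N : Type} [Fintype ι] [Fintype N] [DecidableEq N] {κ : ι → Type}
    [∀ a, Fintype (κ a)] [∀ a, DecidableEq (κ a)] (F : ∀ a, Matrix N (κ a) ℂ) : Prop where
  isometry : ∀ a, (F a)ᴴ * F a = 1
  ortho : ∀ a b, a ≠ b → (F a)ᴴ * F b = 0
  sum_eq_one : ∑ a, F a * (F a)ᴴ = 1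

/-- Isotypic decomposition with respect to a star-closed set `S` of operators: on each summand
`ℂ^k ⊗ ℂ^l`, elements of `S` act on the first factor and elements of the commutant of `S` act on
the second one. -/
theorem exists_isotypic_decomposition (m : ℕ) : ∀ {N : Type} [Fintype N] [DecidableEq N]
    (_ : Fintype.card N = m) (S : Set (Matrix N N ℂ)) (_ : ∀ s ∈ S, sᴴ ∈ S),
    ∃ (ι : Type) (_ : Fintype ι) (k l : ι → ℕ) (F : ∀ a, Matrix N (Fin (k a) × Fin (l a)) ℂ),
      IsOrthoSum F ∧ (∀ a, 0 < k a) ∧ (∀ a, 0 < l a) ∧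
      (∀ s ∈ S, ∀ a, ∃ X : Matrix (Fin (k a)) (Fin (k a)) ℂ, s * F a = F a * (X ⊗ₖ (1 : Matrix (Fin (l a)) (Fin (l a)) ℂ))) ∧
      ∀ t, (∀ s ∈ S, Commute s t) → ∀ a,
        ∃ Y : Matrix (Fin (l a)) (Fin (l a)) ℂ, t * F a = F a * ((1 : Matrix (Fin (k a)) (Fin (k a)) ℂ) ⊗ₖ Y) := by
  classical
  induction m using Nat.strong_induction_on with
  | _ m ih =>
  intro N _ _ hN S hS
  cases isEmpty_or_nonempty N with
  | inl h =>
    exact ⟨Empty, inferInstance, fun _ => 0, fun _ => 0, fun a => a.elim,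
      ⟨fun a => a.elim, fun a => a.elim, Subsingleton.elim _ _⟩, fun a => a.elim, fun a => a.elim,
      fun _ _ a => a.elim, fun _ _ a => a.elim⟩
  | inr h =>
    obtain ⟨k, l, X, F, hk, hl, hF, hSF, hTF⟩ := exists_isotypic_family S hS
    let F₀ : Matrix N (Fin k × Fin l) ℂ := Matrix.of fun x p => F p.2 x p.1
    have hF₀ : F₀ᴴ * F₀ = 1 := by
      ext ⟨i, p⟩ ⟨j, q⟩
      have := congrFun (congrFun (hF p q) i) j
      rw [Matrix.mul_apply] at this ⊢
      refine Eq.trans this ?_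
      by_cases h : p = q <;> simp [h, Matrix.one_apply]
    have hSF₀ : ∀ s ∈ S, s * F₀ = F₀ * (X s ⊗ₖ (1 : Matrix (Fin l) (Fin l) ℂ)) := by
      intro s hs
      ext x ⟨i, p⟩
      have := congrFun (congrFun (hSF s hs p) x) i
      simp only [Matrix.mul_apply] at this ⊢
      refine Eq.trans this ?_
      simp [Fintype.sum_prod_type, Matrix.kroneckerMap_apply, Matrix.one_apply, F₀]
    have hTF₀ : ∀ t, (∀ s ∈ S, Commute s t) →
        ∃ Y : Matrix (Fin l) (Fin l) ℂ, t * F₀ = F₀ * ((1 : Matrix (Fin k) (Fin k) ℂ) ⊗ₖ Y) := by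
      intro t ht
      obtain ⟨Y, hY⟩ := hTF t ht
      refine ⟨Y, ?_⟩
      ext x ⟨i, p⟩
      have := congrFun (congrFun (hY p) x) i
      rw [Matrix.mul_apply] at this ⊢
      refine Eq.trans this ?_
      simp only [Matrix.mul_apply, Fintype.sum_prod_type, Matrix.kroneckerMap_apply,
        Matrix.one_apply, F₀, Matrix.sum_apply]
      rw [Finset.sum_comm]
      simp [mul_comm]
    obtain ⟨m', G, hG, hFG, hsum⟩ := exists_complement hF₀
    have hGF : Gᴴ * F₀ = 0 := by simpa using congrArg Matrix.conjTranspose hFG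
    have hcard := card_add_card_eq hF₀ hG hsum
    simp only [Fintype.card_prod, Fintype.card_fin] at hcard
    have hkl : 0 < k * l := Nat.mul_pos hk hl
    -- whatever maps the range of `F₀` to itself together with its adjoint preserves the complement
    have key : ∀ s : Matrix N N ℂ, (∃ Z : Matrix (Fin k × Fin l) (Fin k × Fin l) ℂ, sᴴ * F₀ = F₀ * Z) →
        s * G = G * (Gᴴ * s * G) := by
      rintro s ⟨Z, hZ⟩
      have h1 : F₀ᴴ * s = Zᴴ * F₀ᴴ := by
        have h := congrArg Matrix.conjTranspose hZ
        rwa [Matrix.conjTranspose_mul, Matrix.conjTranspose_mul,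
          Matrix.conjTranspose_conjTranspose] at h
      calc s * G = (F₀ * F₀ᴴ + G * Gᴴ) * (s * G) := by rw [hsum, Matrix.one_mul]
        _ = F₀ * (F₀ᴴ * s * G) + G * (Gᴴ * s * G) := by
          rw [Matrix.add_mul]; simp only [Matrix.mul_assoc]
        _ = _ := by rw [h1, Matrix.mul_assoc Zᴴ, hFG]; simp
    have hSG : ∀ s ∈ S, s * G = G * (Gᴴ * s * G) := fun s hs =>
      key s ⟨_, hSF₀ _ (hS s hs)⟩
    have hTG : ∀ t, (∀ s ∈ S, Commute s t) → t * G = G * (Gᴴ * t * G) := fun t ht => by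
      refine key t ?_
      obtain ⟨Y, hY⟩ := hTF₀ tᴴ fun s hs => by
        have := (ht _ (hS s hs)).eq
        have := congrArg Matrix.conjTranspose this
        simp only [Matrix.conjTranspose_mul, Matrix.conjTranspose_conjTranspose] at this
        exact this.symm
      exact ⟨_, hY⟩
    obtain ⟨ι, _, k', l', F', hF', hk', hl', hSF', hTF'⟩ :=
      ih m' (by omega) (Fintype.card_fin m') ((fun s => Gᴴ * s * G) '' S) (by
        rintro _ ⟨s, hs, rfl⟩
        exact ⟨sᴴ, hS s hs, by simp [Matrix.conjTranspose_mul, Matrix.mul_assoc]⟩)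
    refine ⟨Option ι, inferInstance, fun a => a.elim k k', fun a => a.elim l l',
      fun a => match a with
        | none => F₀
        | some a => G * F' a, ⟨?_, ?_, ?_⟩, ?_, ?_, ?_, ?_⟩
    · rintro (_ | a)
      · exact hF₀
      · change (G * F' a)ᴴ * (G * F' a) = 1
        rw [Matrix.conjTranspose_mul, Matrix.mul_assoc, ← Matrix.mul_assoc Gᴴ, hG, Matrix.one_mul,
          hF'.isometry]
    · rintro (_ | a) (_ | b) hab
      · exact (hab rfl).elim
      · change F₀ᴴ * (G * F' b) = 0
        rw [← Matrix.mul_assoc, hFG, Matrix.zero_mul]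
      · change (G * F' a)ᴴ * F₀ = 0
        rw [Matrix.conjTranspose_mul, Matrix.mul_assoc, hGF, Matrix.mul_zero]
      · change (G * F' a)ᴴ * (G * F' b) = 0
        rw [Matrix.conjTranspose_mul, Matrix.mul_assoc, ← Matrix.mul_assoc Gᴴ, hG, Matrix.one_mul,
          hF'.ortho a b fun h => hab (by rw [h])]
    · rw [Fintype.sum_option]
      change F₀ * F₀ᴴ + ∑ a, (G * F' a) * (G * F' a)ᴴ = 1
      have : ∑ a, (G * F' a) * (G * F' a)ᴴ = G * (∑ a, F' a * (F' a)ᴴ) * Gᴴ := by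
        simp only [Matrix.mul_sum, Matrix.sum_mul, Matrix.conjTranspose_mul, Matrix.mul_assoc]
      rw [this, hF'.sum_eq_one, Matrix.mul_one, hsum]
    · rintro (_ | a)
      exacts [hk, hk' a]
    · rintro (_ | a)
      exacts [hl, hl' a]
    · rintro s hs (_ | a)
      · exact ⟨_, hSF₀ s hs⟩
      · obtain ⟨X', hX'⟩ := hSF' _ ⟨s, hs, rfl⟩ a
        refine ⟨X', ?_⟩
        change s * (G * F' a) = G * F' a * (X' ⊗ₖ (1 : Matrix (Fin (l' a)) (Fin (l' a)) ℂ))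
        rw [← Matrix.mul_assoc, hSG s hs, Matrix.mul_assoc, hX', Matrix.mul_assoc]
    · rintro t ht (_ | a)
      · exact hTF₀ t ht
      · obtain ⟨Y', hY'⟩ := hTF' (Gᴴ * t * G) (by
          rintro _ ⟨s, hs, rfl⟩
          change (Gᴴ * s * G) * (Gᴴ * t * G) = (Gᴴ * t * G) * (Gᴴ * s * G)
          calc Gᴴ * s * G * (Gᴴ * t * G) = Gᴴ * (s * (G * (Gᴴ * t * G))) := by
                simp only [Matrix.mul_assoc]
            _ = Gᴴ * (t * (G * (Gᴴ * s * G))) := by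
                rw [← hTG t ht, ← hSG s hs, ← Matrix.mul_assoc s, ← Matrix.mul_assoc t,
                  (ht s hs).eq]
            _ = _ := by simp only [Matrix.mul_assoc]) a
        refine ⟨Y', ?_⟩
        change t * (G * F' a) = G * F' a * ((1 : Matrix (Fin (k' a)) (Fin (k' a)) ℂ) ⊗ₖ Y')
        rw [← Matrix.mul_assoc, hTG t ht, Matrix.mul_assoc, hY', Matrix.mul_assoc]

/-! ### Tensor products of operators -/

section TensorOp

variable {ι : Type*} [Fintype ι] {κ : ι → Type*}

theorem tensorOp_mul [DecidableEq ι] [∀ i, Fintype (κ i)] (A B : ∀ i, Matrix (κ i) (κ i) ℂ) :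
    tensorOp A * tensorOp B = tensorOp fun i => A i * B i := by
  ext x y
  simp only [tensorOp, Matrix.mul_apply, ← Finset.prod_mul_distrib]
  exact (Fintype.prod_sum fun i j => A i (x i) j * B i j (y i)).symm

theorem tensorOp_conjTranspose (A : ∀ i, Matrix (κ i) (κ i) ℂ) :
    (tensorOp A)ᴴ = tensorOp fun i => (A i)ᴴ := by
  ext x y
  simp [tensorOp, Matrix.conjTranspose_apply]

theorem tensorOp_one [∀ i, DecidableEq (κ i)] [DecidableEq (∀ i, κ i)] :
    tensorOp (fun i => (1 : Matrix (κ i) (κ i) ℂ)) = 1 := by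
  ext x y
  simp only [tensorOp, Matrix.one_apply, Finset.prod_ite_zero, Finset.prod_const_one, funext_iff]
  simp

variable [DecidableEq ι] [∀ i, DecidableEq (κ i)]

/-- The operator `A ⊗ 1`, with `A` acting on the factor `i`, for arbitrary basis labels. -/
def localOp (i : ι) (A : Matrix (κ i) (κ i) ℂ) : Matrix (∀ i, κ i) (∀ i, κ i) ℂ :=
  tensorOp (Function.update (fun j => (1 : Matrix (κ j) (κ j) ℂ)) i A)

theorem localOp_apply (i : ι) (A : Matrix (κ i) (κ i) ℂ) (x y : ∀ i, κ i) :
    localOp i A x y = if ∀ j, j ≠ i → x j = y j then A (x i) (y i) else 0 := by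
  rw [localOp, tensorOp, ← Finset.mul_prod_erase _ _ (Finset.mem_univ i), Function.update_self]
  have : ∏ j ∈ Finset.univ.erase i,
      Function.update (fun j => (1 : Matrix (κ j) (κ j) ℂ)) i A j (x j) (y j) =
      ∏ j ∈ Finset.univ.erase i, if x j = y j then (1 : ℂ) else 0 := by
    refine Finset.prod_congr rfl fun j hj => ?_
    rw [Function.update_of_ne (Finset.ne_of_mem_erase hj), Matrix.one_apply]
  rw [this, Finset.prod_ite_zero]
  simp

theorem localOp_apply_update (i : ι) (A : Matrix (κ i) (κ i) ℂ) (x : ∀ i, κ i) (a b : κ i) :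
    localOp i A (Function.update x i a) (Function.update x i b) = A a b := by
  rw [localOp_apply, if_pos fun j hj => by simp [hj]]
  simp

theorem localOp_injective [∀ i, Nonempty (κ i)] (i : ι) :
    Function.Injective (localOp (κ := κ) i) := by
  intro A B h
  ext a b
  have x : ∀ i, κ i := fun i => Classical.arbitrary _
  rw [← localOp_apply_update i A x, h, localOp_apply_update]

theorem localOp_one [DecidableEq (∀ i, κ i)] (i : ι) :
    localOp (κ := κ) i 1 = 1 := by
  rw [localOp, Function.update_eq_self_iff.2 rfl, tensorOp_one]

theorem localOp_mul [∀ i, Fintype (κ i)] (i : ι) (A B : Matrix (κ i) (κ i) ℂ) :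
    localOp i (A * B) = localOp i A * localOp i B := by
  rw [localOp, localOp, localOp, tensorOp_mul]
  congr 1
  ext1 j
  by_cases h : j = i
  · subst h; simp
  · simp [h]

theorem localOp_conjTranspose (i : ι) (A : Matrix (κ i) (κ i) ℂ) :
    localOp i Aᴴ = (localOp i A)ᴴ := by
  rw [localOp, localOp, tensorOp_conjTranspose]
  congr 1
  ext1 j
  by_cases h : j = i
  · subst h; simp
  · simp [h]

theorem localOp_add (i : ι) (A B : Matrix (κ i) (κ i) ℂ) :
    localOp i (A + B) = localOp i A + localOp i B := by
  ext x y
  simp only [localOp_apply, Matrix.add_apply]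
  split_ifs <;> simp

theorem localOp_smul {R : Type*} [SMulZeroClass R ℂ] (c : R) (i : ι) (A : Matrix (κ i) (κ i) ℂ) :
    localOp i (c • A) = c • localOp i A := by
  ext x y
  simp only [localOp_apply, Matrix.smul_apply]
  split_ifs <;> simp

theorem localOp_commute [∀ i, Fintype (κ i)] {i j : ι} (h : i ≠ j) (A : Matrix (κ i) (κ i) ℂ)
    (B : Matrix (κ j) (κ j) ℂ) : Commute (localOp i A) (localOp j B) := by
  rw [Commute, SemiconjBy, localOp, localOp, tensorOp_mul, tensorOp_mul]
  congr 1
  ext1 k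
  by_cases hi : k = i
  · subst hi; simp [h]
  · simp [hi]

end TensorOp

theorem onSite_eq_localOp {n : ℕ} {d : Fin n → ℕ} (i : Fin n)
    (A : Matrix (Fin (d i)) (Fin (d i)) ℂ) : onSite i A = localOp (κ := fun i => Fin (d i)) i A :=
  rfl

/-! ### Joint decomposition for commuting families of operators -/

/-- Splitting off the first factor of a product of `n + 1` bases. -/
def consSplit {n : ℕ} (m : ℕ) (k : Fin (n + 1) → ℕ) :
    (Fin m × ∀ i, Fin (k i)) ≃ Fin (k 0) × (Fin m × ∀ i : Fin n, Fin (k i.succ)) where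
  toFun p := (p.2 0, (p.1, fun i : Fin n => p.2 i.succ))
  invFun q := (q.2.1, Fin.cons (α := fun i => Fin (k i)) q.1 q.2.2)
  left_inv p := Prod.ext rfl (funext fun i => by cases i using Fin.cases <;> rfl)
  right_inv _ := rfl

theorem consSplit_apply {n : ℕ} (m : ℕ) (k : Fin (n + 1) → ℕ) (p : Fin m × ∀ i, Fin (k i)) :
    consSplit m k p = (p.2 0, (p.1, fun i : Fin n => p.2 i.succ)) := rfl

theorem consSplit_zero {n : ℕ} (m : ℕ) (k : Fin (n + 1) → ℕ)
    (X : Matrix (Fin (k 0)) (Fin (k 0)) ℂ) :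
    (X ⊗ₖ (1 : Matrix (Fin m × ∀ i : Fin n, Fin (k i.succ))
        (Fin m × ∀ i : Fin n, Fin (k i.succ)) ℂ)).submatrix (consSplit m k) (consSplit m k) =
      (1 : Matrix (Fin m) (Fin m) ℂ) ⊗ₖ localOp (κ := fun i => Fin (k i)) 0 X := by
  ext ⟨p, x⟩ ⟨q, y⟩
  simp only [Matrix.submatrix_apply, Matrix.kroneckerMap_apply, localOp_apply, Matrix.one_apply,
    consSplit_apply, Fin.forall_fin_succ, Prod.mk.injEq, funext_iff]
  by_cases h : p = q <;> simp [h]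

theorem consSplit_succ {n : ℕ} (m : ℕ) (k : Fin (n + 1) → ℕ) (j : Fin n)
    (X : Matrix (Fin (k j.succ)) (Fin (k j.succ)) ℂ) :
    ((1 : Matrix (Fin (k 0)) (Fin (k 0)) ℂ) ⊗ₖ ((1 : Matrix (Fin m) (Fin m) ℂ) ⊗ₖ
        localOp (κ := fun i : Fin n => Fin (k i.succ)) j X)).submatrix
        (consSplit m k) (consSplit m k) =
      (1 : Matrix (Fin m) (Fin m) ℂ) ⊗ₖ localOp (κ := fun i => Fin (k i)) j.succ X := by
  ext ⟨p, x⟩ ⟨q, y⟩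
  simp only [Matrix.submatrix_apply, Matrix.kroneckerMap_apply, localOp_apply, Matrix.one_apply,
    consSplit_apply, Fin.forall_fin_succ, ne_eq, Fin.succ_inj]
  by_cases h : p = q <;> by_cases h' : x 0 = y 0 <;>
    simp [h, h', (Fin.succ_ne_zero j).symm]

theorem one_kronecker_injective {p q : Type*} [DecidableEq p] [Nonempty p]
    {Y Z : Matrix q q ℂ} (h : (1 : Matrix p p ℂ) ⊗ₖ Y = (1 : Matrix p p ℂ) ⊗ₖ Z) : Y = Z := by
  ext a b
  simpa using congrFun (congrFun h (Classical.arbitrary p, a)) (Classical.arbitrary p, b)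

/-- If `s` and `sᴴ` both leave the range of the isometry `F` invariant, they act there by mutually
adjoint matrices. -/
theorem conjTranspose_mul_isometry {N p : Type} [Fintype N] [DecidableEq N] [Fintype p]
    [DecidableEq p] {F : Matrix N p ℂ} (hF : Fᴴ * F = 1) {s : Matrix N N ℂ} {X Y : Matrix p p ℂ}
    (h : s * F = F * X) (h' : sᴴ * F = F * Y) : Y = Xᴴ := by
  have h1 := congrArg Matrix.conjTranspose h'
  rw [Matrix.conjTranspose_mul, Matrix.conjTranspose_mul, Matrix.conjTranspose_conjTranspose] at h1
  have h2 : Fᴴ * s * F = X := by rw [Matrix.mul_assoc, h, ← Matrix.mul_assoc, hF, Matrix.one_mul]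
  rw [h1, Matrix.mul_assoc, hF, Matrix.mul_one] at h2
  rw [← h2, Matrix.conjTranspose_conjTranspose]

theorem eq_of_isometry_mul {N p : Type} [Fintype N] [DecidableEq N] [Fintype p]
    [DecidableEq p] {F : Matrix N p ℂ} (hF : Fᴴ * F = 1) {X Y : Matrix p p ℂ}
    (h : F * X = F * Y) : X = Y := by
  have := congrArg (Fᴴ * ·) h
  simpa [← Matrix.mul_assoc, hF] using this

theorem IsOrthoSum.submatrix {ι N : Type} [Fintype ι] [Fintype N] [DecidableEq N]
    {κ κ' : ι → Type} [∀ a, Fintype (κ a)] [∀ a, DecidableEq (κ a)] [∀ a, Fintype (κ' a)]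
    [∀ a, DecidableEq (κ' a)] {F : ∀ a, Matrix N (κ a) ℂ} (hF : IsOrthoSum F)
    (e : ∀ a, κ' a ≃ κ a) : IsOrthoSum fun a => (F a).submatrix id (e a) := by
  have h : ∀ a b, ((F a).submatrix id (e a))ᴴ * (F b).submatrix id (e b) =
      ((F a)ᴴ * F b).submatrix (e a) (e b) := fun a b => by
    rw [Matrix.conjTranspose_submatrix, Matrix.submatrix_mul _ _ _ id _ Function.bijective_id]
  refine ⟨fun a => ?_, fun a b hab => ?_, ?_⟩
  · rw [h, hF.isometry, Matrix.submatrix_one_equiv]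
  · rw [h, hF.ortho a b hab]; rfl
  · rw [← hF.sum_eq_one]
    refine Finset.sum_congr rfl fun a _ => ?_
    rw [Matrix.conjTranspose_submatrix, Matrix.submatrix_mul_equiv, Matrix.submatrix_id_id]

theorem mul_submatrix_of_mul_eq {N p q : Type} [Fintype N] [Fintype p] [Fintype q]
    (e : q ≃ p) {s : Matrix N N ℂ} {F : Matrix N p ℂ} {X : Matrix p p ℂ} (h : s * F = F * X) :
    s * F.submatrix id e = F.submatrix id e * X.submatrix e e := by
  rw [Matrix.submatrix_mul_equiv, ← h, Matrix.submatrix_mul _ _ _ id _ Function.bijective_id,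
    Matrix.submatrix_id_id]

/-- For pairwise commuting star-closed sets `S i` of operators, the space is a direct sum of
tensor products `ℂ^l ⊗ ⨂ i, ℂ^(k i)` in which `S i` acts on the factor `i` only. -/
theorem exists_joint_decomposition (n : ℕ) : ∀ {N : Type} [Fintype N] [DecidableEq N]
    (S : Fin n → Set (Matrix N N ℂ)) (_ : ∀ i, ∀ s ∈ S i, sᴴ ∈ S i)
    (_ : ∀ i j, i ≠ j → ∀ s ∈ S i, ∀ t ∈ S j, Commute s t),
    ∃ (ι : Type) (_ : Fintype ι) (l : ι → ℕ) (k : ι → Fin n → ℕ)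
      (F : ∀ a, Matrix N (Fin (l a) × ∀ i, Fin (k a i)) ℂ),
      IsOrthoSum F ∧ (∀ a, 0 < l a) ∧ (∀ a i, 0 < k a i) ∧
      ∀ i, ∀ s ∈ S i, ∀ a, ∃ X : Matrix (Fin (k a i)) (Fin (k a i)) ℂ,
        s * F a = F a * ((1 : Matrix (Fin (l a)) (Fin (l a)) ℂ) ⊗ₖ
          localOp (κ := fun i => Fin (k a i)) i X) := by
  classical
  induction n with
  | zero =>
    intro N _ _ S _ _
    cases isEmpty_or_nonempty N with
    | inl h =>
      exact ⟨Empty, inferInstance, fun _ => 0, fun _ => finZeroElim, fun a => a.elim,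
        ⟨fun a => a.elim, fun a => a.elim, Subsingleton.elim _ _⟩, fun a => a.elim,
        fun a => a.elim, fun i => i.elim0⟩
    | inr h =>
      let k : Fin 0 → ℕ := fun _ => 0
      let e : (Fin (Fintype.card N) × ∀ i, Fin (k i)) ≃ N :=
        (Equiv.prodUnique _ _).trans (Fintype.equivFin N).symm
      refine ⟨Unit, inferInstance, fun _ => Fintype.card N, fun _ => k,
        fun _ => (1 : Matrix N N ℂ).submatrix id e, ⟨fun _ => ?_, fun a b h => ?_, ?_⟩,
        fun _ => Fintype.card_pos, fun _ i => i.elim0, fun i => i.elim0⟩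
      · rw [Matrix.conjTranspose_submatrix,
          ← Matrix.submatrix_mul _ _ _ id _ Function.bijective_id]
        simp
      · exact (h rfl).elim
      · simp [Matrix.submatrix_mul_equiv]
  | succ n ih =>
    intro N _ _ S hstar hcomm
    obtain ⟨ι₁, _, k₁, l₁, F₁, hF₁, hk₁, hl₁, hS₁, hT₁⟩ :=
      exists_isotypic_decomposition _ rfl (S 0) (hstar 0)
    have (β : ι₁) : Nonempty (Fin (k₁ β)) := ⟨⟨0, hk₁ β⟩⟩
    let S' : ∀ β, Fin n → Set (Matrix (Fin (l₁ β)) (Fin (l₁ β)) ℂ) := fun β j =>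
      {Y | ∃ s ∈ S j.succ, s * F₁ β = F₁ β * ((1 : Matrix (Fin (k₁ β)) (Fin (k₁ β)) ℂ) ⊗ₖ Y)}
    have hact : ∀ j, ∀ s ∈ S (Fin.succ j), ∀ β, ∃ Y : Matrix (Fin (l₁ β)) (Fin (l₁ β)) ℂ,
        s * F₁ β = F₁ β * ((1 : Matrix (Fin (k₁ β)) (Fin (k₁ β)) ℂ) ⊗ₖ Y) := fun j s hs =>
      hT₁ s fun r hr => hcomm _ _ (Fin.succ_ne_zero j).symm r hr s hs
    have hstar' : ∀ β j, ∀ Y ∈ S' β j, Yᴴ ∈ S' β j := by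
      rintro β j Y ⟨s, hs, hY⟩
      obtain ⟨Z, hZ⟩ := hact j sᴴ (hstar _ s hs) β
      have h := conjTranspose_mul_isometry (hF₁.isometry β) hY hZ
      rw [Matrix.conjTranspose_kronecker, Matrix.conjTranspose_one] at h
      refine ⟨sᴴ, hstar _ s hs, ?_⟩
      rw [hZ, h]
    have hcomm' : ∀ β i j, i ≠ j → ∀ Y ∈ S' β i, ∀ Z ∈ S' β j, Commute Y Z := by
      rintro β i j hij Y ⟨s, hs, hY⟩ Z ⟨t, ht, hZ⟩
      refine one_kronecker_injective (p := Fin (k₁ β)) (eq_of_isometry_mul (hF₁.isometry β) ?_)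
      have h1 : s * t * F₁ β =
          F₁ β * ((1 : Matrix (Fin (k₁ β)) (Fin (k₁ β)) ℂ) ⊗ₖ (Y * Z)) := by
        rw [Matrix.mul_assoc, hZ, ← Matrix.mul_assoc, hY, Matrix.mul_assoc,
          ← Matrix.mul_kronecker_mul, Matrix.one_mul]
      have h2 : t * s * F₁ β =
          F₁ β * ((1 : Matrix (Fin (k₁ β)) (Fin (k₁ β)) ℂ) ⊗ₖ (Z * Y)) := by
        rw [Matrix.mul_assoc, hY, ← Matrix.mul_assoc, hZ, Matrix.mul_assoc,
          ← Matrix.mul_kronecker_mul, Matrix.one_mul]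
      rw [← h1, ← h2, (hcomm _ _ (by simpa using hij) s hs t ht).eq]
    choose ι₂ _ l₂ k₂ F₂ hF₂ hl₂ hk₂ hS₂ using fun β => ih (S' β) (hstar' β) (hcomm' β)
    let G : ∀ a : Σ β, ι₂ β, Matrix N (Fin (k₁ a.1) × (Fin (l₂ a.1 a.2) ×
        ∀ i, Fin (k₂ a.1 a.2 i))) ℂ := fun a =>
      F₁ a.1 * ((1 : Matrix (Fin (k₁ a.1)) (Fin (k₁ a.1)) ℂ) ⊗ₖ F₂ a.1 a.2)
    have hG : IsOrthoSum G := by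
      refine ⟨fun a => ?_, ?_, ?_⟩
      · simp only [G]
        rw [Matrix.conjTranspose_mul, Matrix.mul_assoc, ← Matrix.mul_assoc _ (F₁ a.1),
          hF₁.isometry, Matrix.one_mul, Matrix.conjTranspose_kronecker,
          ← Matrix.mul_kronecker_mul, (hF₂ a.1).isometry]
        simp
      · rintro ⟨β, γ⟩ ⟨β', γ'⟩ hab
        simp only [G]
        rw [Matrix.conjTranspose_mul, Matrix.mul_assoc, ← Matrix.mul_assoc _ (F₁ β')]
        by_cases hβ : β = β'
        · subst hβ
          rw [hF₁.isometry, Matrix.one_mul, Matrix.conjTranspose_kronecker,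
            ← Matrix.mul_kronecker_mul, (hF₂ β).ortho γ γ' fun h => hab (by rw [h])]
          simp
        · rw [hF₁.ortho β β' hβ]
          simp
      · have h1 : ∀ a : Σ β, ι₂ β, G a * (G a)ᴴ =
            F₁ a.1 * ((1 : Matrix (Fin (k₁ a.1)) (Fin (k₁ a.1)) ℂ) ⊗ₖ
              (F₂ a.1 a.2 * (F₂ a.1 a.2)ᴴ)) * (F₁ a.1)ᴴ := by
          intro a
          simp only [G]
          rw [Matrix.conjTranspose_mul, Matrix.conjTranspose_kronecker, Matrix.mul_assoc,
            ← Matrix.mul_assoc (_ ⊗ₖ _), ← Matrix.mul_kronecker_mul, ← Matrix.mul_assoc]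
          simp
        rw [Finset.sum_congr rfl fun a _ => h1 a, Fintype.sum_sigma, ← hF₁.sum_eq_one]
        refine Finset.sum_congr rfl fun β _ => ?_
        change ∑ γ, F₁ β * ((1 : Matrix (Fin (k₁ β)) (Fin (k₁ β)) ℂ) ⊗ₖ
          (F₂ β γ * (F₂ β γ)ᴴ)) * (F₁ β)ᴴ = F₁ β * (F₁ β)ᴴ
        rw [← Matrix.sum_mul, ← Matrix.mul_sum]
        have : ∑ γ, (1 : Matrix (Fin (k₁ β)) (Fin (k₁ β)) ℂ) ⊗ₖ (F₂ β γ * (F₂ β γ)ᴴ) = 1 := by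
          rw [← Matrix.one_kronecker_one, ← (hF₂ β).sum_eq_one]
          ext x y
          simp [Matrix.sum_apply, Finset.mul_sum]
        rw [this, Matrix.mul_one]
    -- the same isometries, with their labels read as values of one family of dimensions
    let K : (Σ β, ι₂ β) → Fin (n + 1) → ℕ := fun a => Fin.cons (k₁ a.1) (k₂ a.1 a.2)
    let G' : ∀ a : Σ β, ι₂ β, Matrix N (Fin (K a 0) × (Fin (l₂ a.1 a.2) ×
        ∀ i : Fin n, Fin (K a i.succ))) ℂ := G
    have hG' : IsOrthoSum G' := hG
    let e := fun a => consSplit (l₂ a.1 a.2) (K a)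
    refine ⟨Σ β, ι₂ β, inferInstance, fun a => l₂ a.1 a.2, K,
      fun a => (G' a).submatrix id (e a), hG'.submatrix e, fun a => hl₂ a.1 a.2, ?_, ?_⟩
    · intro a i
      cases i using Fin.cases with
      | zero => exact hk₁ a.1
      | succ j => exact hk₂ a.1 a.2 j
    · intro i s hs a
      cases i using Fin.cases with
      | zero =>
        obtain ⟨X, hX⟩ := hS₁ s hs a.1
        have h : s * G a = G a * (X ⊗ₖ (1 : Matrix (Fin (l₂ a.1 a.2) × ∀ i, Fin (k₂ a.1 a.2 i))
            (Fin (l₂ a.1 a.2) × ∀ i, Fin (k₂ a.1 a.2 i)) ℂ)) := by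
          simp only [G]
          rw [← Matrix.mul_assoc, hX, Matrix.mul_assoc, Matrix.mul_assoc,
            ← Matrix.mul_kronecker_mul, ← Matrix.mul_kronecker_mul]
          simp
        let X' : Matrix (Fin (K a 0)) (Fin (K a 0)) ℂ := X
        have h' : s * G' a = G' a * (X' ⊗ₖ (1 : Matrix (Fin (l₂ a.1 a.2) ×
          ∀ i : Fin n, Fin (K a i.succ)) (Fin (l₂ a.1 a.2) × ∀ i : Fin n, Fin (K a i.succ)) ℂ)) := h
        refine ⟨X', ?_⟩
        rw [mul_submatrix_of_mul_eq (e a) h', consSplit_zero]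
      | succ j =>
        obtain ⟨Y, hY⟩ := hact j s hs a.1
        obtain ⟨X, hX⟩ := hS₂ a.1 j Y ⟨s, hs, hY⟩ a.2
        have h : s * G a = G a * ((1 : Matrix (Fin (k₁ a.1)) (Fin (k₁ a.1)) ℂ) ⊗ₖ
            ((1 : Matrix (Fin (l₂ a.1 a.2)) (Fin (l₂ a.1 a.2)) ℂ) ⊗ₖ
              localOp (κ := fun i => Fin (k₂ a.1 a.2 i)) j X)) := by
          simp only [G]
          rw [← Matrix.mul_assoc, hY, Matrix.mul_assoc, Matrix.mul_assoc,
            ← Matrix.mul_kronecker_mul, ← Matrix.mul_kronecker_mul, hX]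
        let X' : Matrix (Fin (K a j.succ)) (Fin (K a j.succ)) ℂ := X
        have h' : s * G' a = G' a * ((1 : Matrix (Fin (K a 0)) (Fin (K a 0)) ℂ) ⊗ₖ
            ((1 : Matrix (Fin (l₂ a.1 a.2)) (Fin (l₂ a.1 a.2)) ℂ) ⊗ₖ
              localOp (κ := fun i : Fin n => Fin (K a i.succ)) j X')) := h
        refine ⟨X', ?_⟩
        rw [mul_submatrix_of_mul_eq (e a) h', consSplit_succ]

/-! ### Operators acting on a subset of the sites -/

section ActsOnlyOn

variable {ι : Type*} [Fintype ι] [DecidableEq ι] {d : ι → ℕ}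

theorem res_prod_bijective (S : Finset ι) :
    Function.Bijective fun x : Cfg d => (res S x, res Sᶜ x) := by
  constructor
  · intro x y h
    rw [Prod.mk.injEq] at h
    ext1 j
    by_cases hj : j ∈ S
    · exact congrFun h.1 ⟨j, hj⟩
    · exact congrFun h.2 ⟨j, Finset.mem_compl.2 hj⟩
  · rintro ⟨a, b⟩
    refine ⟨fun j => if h : j ∈ S then a ⟨j, h⟩ else b ⟨j, Finset.mem_compl.2 h⟩, ?_⟩
    ext1
    · ext1 ⟨j, hj⟩
      simp [res, hj]
    · ext1 ⟨j, hj⟩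
      simp [res, Finset.mem_compl.1 hj]

theorem extendOp_apply (S : Finset ι) (Y : Op fun j : S => d j) (x y : Cfg d) :
    extendOp S Y x y = if ∀ j, j ∉ S → x j = y j then Y (res S x) (res S y) else 0 := by
  have : res Sᶜ x = res Sᶜ y ↔ ∀ j, j ∉ S → x j = y j := by
    simp [funext_iff, res]
  simp [extendOp, Matrix.one_apply, this]

theorem extendOp_mul (S : Finset ι) (Y Z : Op fun j : S => d j) :
    extendOp S (Y * Z) = extendOp S Y * extendOp S Z := by
  rw [extendOp, extendOp, extendOp, ← Matrix.submatrix_mul _ _ _ _ _ (res_prod_bijective S),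
    ← Matrix.mul_kronecker_mul, Matrix.one_mul]

theorem extendOp_one (S : Finset ι) : extendOp S (1 : Op fun j : S => d j) = 1 := by
  rw [extendOp, Matrix.one_kronecker_one, Matrix.submatrix_one _ (res_prod_bijective S).1]

theorem extendOp_conjTranspose (S : Finset ι) (Y : Op fun j : S => d j) :
    (extendOp S Y)ᴴ = extendOp S Yᴴ := by
  rw [extendOp, extendOp, Matrix.conjTranspose_submatrix, Matrix.conjTranspose_kronecker,
    Matrix.conjTranspose_one]

theorem ActsOnlyOn.add {S : Finset ι} {X Z : Op d} (hX : ActsOnlyOn S X) (hZ : ActsOnlyOn S Z) :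
    ActsOnlyOn S (X + Z) := by
  obtain ⟨X, rfl⟩ := hX
  obtain ⟨Z, rfl⟩ := hZ
  refine ⟨X + Z, ?_⟩
  ext x y
  simp only [Matrix.add_apply, extendOp_apply]
  split_ifs <;> simp

theorem ActsOnlyOn.mul {S : Finset ι} {X Z : Op d} (hX : ActsOnlyOn S X) (hZ : ActsOnlyOn S Z) :
    ActsOnlyOn S (X * Z) := by
  obtain ⟨X, rfl⟩ := hX
  obtain ⟨Z, rfl⟩ := hZ
  exact ⟨X * Z, (extendOp_mul S X Z).symm⟩

theorem ActsOnlyOn.mono {S T : Finset ι} (hST : S ⊆ T) {X : Op d} (hX : ActsOnlyOn S X) :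
    ActsOnlyOn T X := by
  obtain ⟨Y, rfl⟩ := hX
  refine ⟨Matrix.of fun a b => if ∀ j : T, (j : ι) ∉ S → a j = b j then
    Y (fun j => a ⟨j, hST j.2⟩) (fun j => b ⟨j, hST j.2⟩) else 0, ?_⟩
  ext x y
  rw [extendOp_apply, extendOp_apply, Matrix.of_apply, ← ite_and]
  refine if_congr ⟨fun h => ⟨fun j hj => h j fun h' => hj (hST h'), fun j hj => h j hj⟩,
    fun h j hj => ?_⟩ rfl rfl
  by_cases hjT : j ∈ T
  · exact h.2 ⟨j, hjT⟩ hj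
  · exact h.1 j hjT

/-- The matrix unit `|a⟩⟨b|` on the sites in `T`, as a product operator. -/
theorem tensorOp_single_apply (T : Finset ι) (a b : Cfg fun j : T => d j) (x y : Cfg d) :
    tensorOp (fun i => if h : i ∈ T then Matrix.single (a ⟨i, h⟩) (b ⟨i, h⟩) (1 : ℂ) else 1) x y =
      if (∀ j, j ∉ T → x j = y j) ∧ a = res T x ∧ b = res T y then 1 else 0 := by
  have h1 : ∀ i, (if h : i ∈ T then Matrix.single (a ⟨i, h⟩) (b ⟨i, h⟩) (1 : ℂ) else 1)
      (x i) (y i) = if (if h : i ∈ T then a ⟨i, h⟩ = x i ∧ b ⟨i, h⟩ = y i else x i = y i) then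
        (1 : ℂ) else 0 := by
    intro i
    by_cases h : i ∈ T
    · simp [h, Matrix.single_apply]
    · simp [h, Matrix.one_apply]
  rw [tensorOp, Finset.prod_congr rfl fun i _ => h1 i, Finset.prod_ite_zero, Finset.prod_const_one]
  have key : (∀ i ∈ Finset.univ, if h : i ∈ T then a ⟨i, h⟩ = x i ∧ b ⟨i, h⟩ = y i else x i = y i) ↔
      (∀ j, j ∉ T → x j = y j) ∧ a = res T x ∧ b = res T y := by
    refine ⟨fun h => ⟨fun j hj => ?_, funext fun j => ?_, funext fun j => ?_⟩, fun h i _ => ?_⟩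
    · simpa [hj] using h j (Finset.mem_univ _)
    · have := h j (Finset.mem_univ _)
      rw [dif_pos j.2] at this
      exact this.1
    · have := h j (Finset.mem_univ _)
      rw [dif_pos j.2] at this
      exact this.2
    · by_cases hi : i ∈ T
      · rw [dif_pos hi, h.2.1, h.2.2]
        exact ⟨rfl, rfl⟩
      · rw [dif_neg hi]
        exact h.1 i hi
  by_cases hk : (∀ j, j ∉ T → x j = y j) ∧ a = res T x ∧ b = res T y
  · rw [if_pos hk, if_pos (key.2 hk)]
  · rw [if_neg hk, if_neg fun h => hk (key.1 h)]

theorem extendOp_eq_sum (T : Finset ι) (Y : Op fun j : T => d j) :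
    extendOp T Y = ∑ a, ∑ b, Y a b •
      tensorOp (fun i => if h : i ∈ T then Matrix.single (a ⟨i, h⟩) (b ⟨i, h⟩) (1 : ℂ) else 1) := by
  ext x y
  simp only [Matrix.sum_apply, Matrix.smul_apply, tensorOp_single_apply, extendOp_apply, ite_and]
  by_cases h : ∀ j, j ∉ T → x j = y j
  · simp only [if_pos h]
    simp
  · simp [if_neg h]

end ActsOnlyOn

/-- The 1-local operators on the sites in a nonempty set `T` generate, under sums and products
alone, all operators that act on `T`; scalars are themselves 1-local. -/
theorem ActsOnlyOn.induction {n : ℕ} {d : Fin n → ℕ} {T : Finset (Fin n)} (hT : T.Nonempty)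
    {P : Op d → Prop} (hadd : ∀ A B, P A → P B → P (A + B)) (hmul : ∀ A B, P A → P B → P (A * B))
    (hsite : ∀ i ∈ T, ∀ A : Matrix (Fin (d i)) (Fin (d i)) ℂ, P (onSite i A))
    {M : Op d} (hM : ActsOnlyOn T M) : P M := by
  obtain ⟨i₀, hi₀⟩ := hT
  have hsmul1 : ∀ c : ℂ, P (c • 1) := fun c => by
    have := hsite i₀ hi₀ (c • 1)
    rwa [onSite_eq_localOp, localOp_smul, localOp_one] at this
  have hsmul : ∀ (c : ℂ) A, P A → P (c • A) := fun c A hA => by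
    have := hmul _ _ (hsmul1 c) hA
    rwa [Matrix.smul_mul, Matrix.one_mul] at this
  have h0 : P 0 := by simpa using hsmul1 0
  have hprod : ∀ (A : ∀ i, Matrix (Fin (d i)) (Fin (d i)) ℂ) (R : Finset (Fin n)), R ⊆ T →
      P (tensorOp fun i => if i ∈ R then A i else 1) := by
    intro A R
    induction R using Finset.induction_on with
    | empty =>
      intro _
      have := hsmul1 1
      simpa [tensorOp_one] using this
    | insert j R hj ih =>
      intro hR
      have := hmul _ _ (ih fun i hi => hR (Finset.mem_insert_of_mem hi))
        (hsite j (hR (Finset.mem_insert_self j R)) (A j))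
      rw [onSite, tensorOp_mul] at this
      convert this using 2
      ext1 i
      by_cases hi : i = j
      · subst hi; simp [hj]
      · simp [hi]
  obtain ⟨Y, rfl⟩ := hM
  rw [extendOp_eq_sum]
  refine Finset.sum_induction _ P hadd h0 fun a _ => Finset.sum_induction _ P hadd h0 fun b _ =>
    hsmul _ _ ?_
  have := hprod (fun i => if h : i ∈ T then Matrix.single (a ⟨i, h⟩) (b ⟨i, h⟩) (1 : ℂ) else 1) T
    subset_rfl
  convert this using 2
  ext1 i
  by_cases h : i ∈ T <;> simp [h]

theorem actsOnlyOn_univ {ι : Type*} [Fintype ι] [DecidableEq ι] {d : ι → ℕ} (M : Op d) :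
    ActsOnlyOn Finset.univ M := by
  refine ⟨Matrix.of fun a b =>
    M (fun j => a ⟨j, Finset.mem_univ j⟩) (fun j => b ⟨j, Finset.mem_univ j⟩), ?_⟩
  ext x y
  rw [extendOp_apply, if_pos fun j hj => (hj (Finset.mem_univ j)).elim]
  rfl

/-! ### Encodings -/

section Encoding

variable {κ κ' κ'' : Type*} [Fintype κ] [DecidableEq κ] [Fintype κ'] [DecidableEq κ']
  [Fintype κ''] [DecidableEq κ'']

theorem IsEncoding.map_zero {E : Matrix κ κ ℂ → Matrix κ' κ' ℂ} (hE : IsEncoding E) : E 0 = 0 := by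
  have := hE.map_add 0 0
  simpa using this

theorem IsEncoding.map_sum {E : Matrix κ κ ℂ → Matrix κ' κ' ℂ} (hE : IsEncoding E) {ι : Type*}
    (s : Finset ι) (f : ι → Matrix κ κ ℂ) : E (∑ i ∈ s, f i) = ∑ i ∈ s, E (f i) := by
  classical
  induction s using Finset.induction_on with
  | empty => simpa using hE.map_zero
  | insert j s hj ih => rw [Finset.sum_insert hj, Finset.sum_insert hj, hE.map_add, ih]

theorem IsEncoding.map_neg {E : Matrix κ κ ℂ → Matrix κ' κ' ℂ} (hE : IsEncoding E)
    (A : Matrix κ κ ℂ) : E (-A) = -E A := by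
  have := hE.map_real_smul (-1) A
  simpa using this

theorem IsEncoding.comp {E : Matrix κ κ ℂ → Matrix κ' κ' ℂ} {G : Matrix κ' κ' ℂ → Matrix κ'' κ'' ℂ}
    (hG : IsEncoding G) (hE : IsEncoding E) : IsEncoding (G ∘ E) where
  map_one := by simp [hE.map_one, hG.map_one]
  map_conjTranspose A := by simp [hE.map_conjTranspose, hG.map_conjTranspose]
  map_add A B := by simp [hE.map_add, hG.map_add]
  map_mul A B := by simp [hE.map_mul, hG.map_mul]
  map_real_smul x A := by simp [hE.map_real_smul, hG.map_real_smul]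

theorem isEncoding_id : IsEncoding (id : Matrix κ κ ℂ → Matrix κ κ ℂ) :=
  ⟨rfl, fun _ => rfl, fun _ _ => rfl, fun _ _ => rfl, fun _ _ => rfl⟩

theorem isEncoding_conjOp : IsEncoding (conjOp : Matrix κ κ ℂ → Matrix κ κ ℂ) where
  map_one := by ext i j; simp [conjOp, Matrix.one_apply, apply_ite]
  map_conjTranspose A := by ext i j; simp [conjOp]
  map_add A B := by ext i j; simp [conjOp]
  map_mul A B := by ext i j; simp [conjOp, Matrix.mul_apply]
  map_real_smul x A := by ext i j; simp [conjOp]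

/-- Equality with `E` on 1-local operators determines an encoding. -/
theorem IsEncoding.eq_of_onSite {n : ℕ} (hn : 0 < n) {d : Fin n → ℕ}
    {E E₂ : Op d → Matrix κ' κ' ℂ} (hE : IsEncoding E) (hE₂ : IsEncoding E₂)
    (h : ∀ (i : Fin n) (A : Matrix (Fin (d i)) (Fin (d i)) ℂ), E₂ (onSite i A) = E (onSite i A)) :
    E₂ = E := by
  ext1 M
  refine ActsOnlyOn.induction (T := Finset.univ) ⟨⟨0, hn⟩, Finset.mem_univ _⟩
    (P := fun M => E₂ M = E M) (fun A B hA hB => ?_) (fun A B hA hB => ?_) (fun i _ A => h i A)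
    (actsOnlyOn_univ M)
  · rw [hE.map_add, hE₂.map_add, hA, hB]
  · rw [hE.map_mul, hE₂.map_mul, hA, hB]

theorem IsLocalEncoding.actsOnlyOn_biUnion {n n' : ℕ} {d : Fin n → ℕ} {d' : Fin n' → ℕ}
    {S : Fin n → Finset (Fin n')} {E : Op d → Op d'} (hE : IsLocalEncoding S E)
    {T : Finset (Fin n)} (hT : T.Nonempty) {M : Op d} (hM : ActsOnlyOn T M) :
    ActsOnlyOn (T.biUnion S) (E M) := by
  refine ActsOnlyOn.induction hT (P := fun M => ActsOnlyOn (T.biUnion S) (E M))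
    (fun A B hA hB => ?_) (fun A B hA hB => ?_) (fun i hi A => ?_) hM
  · rw [hE.isEncoding.map_add]; exact hA.add hB
  · rw [hE.isEncoding.map_mul]; exact hA.mul hB
  · exact (hE.actsOnlyOn i A).mono (Finset.subset_biUnion_of_mem S hi)

theorem IsEncoding.map_complex_smul {E : Matrix κ κ ℂ → Matrix κ' κ' ℂ} (hE : IsEncoding E)
    (hI : E (Complex.I • 1) = Complex.I • 1) (c : ℂ) (A : Matrix κ κ ℂ) : E (c • A) = c • E A := by
  have h1 : c • A = c.re • A + c.im • ((Complex.I • 1 : Matrix κ κ ℂ) * A) := by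
    ext i j
    conv_lhs => rw [← Complex.re_add_im c]
    simp only [Matrix.add_apply, Matrix.smul_apply, Matrix.smul_mul, Matrix.one_mul,
      Complex.real_smul, smul_eq_mul]
    ring
  have h2 : c • E A = c.re • E A + c.im • ((Complex.I • 1 : Matrix κ' κ' ℂ) * E A) := by
    ext i j
    conv_lhs => rw [← Complex.re_add_im c]
    simp only [Matrix.add_apply, Matrix.smul_apply, Matrix.smul_mul, Matrix.one_mul,
      Complex.real_smul, smul_eq_mul]
    ring
  rw [h1, hE.map_add, hE.map_real_smul, hE.map_real_smul, hE.map_mul, hI, h2]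

end Encoding

/-- A complex-linear encoding is an amplification `A ↦ A ⊗ 1` up to a unitary. -/
theorem IsEncoding.exists_unitary_of_map_I {κ N : Type} [Fintype κ] [DecidableEq κ] [Nonempty κ]
    [Fintype N] [DecidableEq N] {E : Matrix κ κ ℂ → Matrix N N ℂ} (hE : IsEncoding E)
    (hI : E (Complex.I • 1) = Complex.I • 1) :
    ∃ (m : ℕ) (W : Matrix N (κ × Fin m) ℂ), Wᴴ * W = 1 ∧ W * Wᴴ = 1 ∧
      ∀ A, E A = W * (A ⊗ₖ (1 : Matrix (Fin m) (Fin m) ℂ)) * Wᴴ := by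
  let o : κ := Classical.arbitrary κ
  let e : κ → κ → Matrix N N ℂ := fun i j => E (Matrix.single i j 1)
  have he : ∀ i j k l, e i j * e k l = if j = k then e i l else 0 := by
    intro i j k l
    simp only [e]
    rw [← hE.map_mul]
    split_ifs with h
    · subst h
      rw [Matrix.single_mul_single_same, mul_one]
    · rw [Matrix.single_mul_single_of_ne _ _ _ _ h, hE.map_zero]
  have hes : ∀ i j, (e i j)ᴴ = e j i := by
    intro i j
    simp only [e]
    rw [← hE.map_conjTranspose, Matrix.conjTranspose_single, star_one]
  have hesum : ∑ i, e i i = 1 := by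
    simp only [e]
    rw [← hE.map_sum, ← hE.map_one]
    congr 1
    ext a b
    simp [Matrix.sum_apply, Matrix.single_apply, Matrix.one_apply, ite_and]
  have hEA : ∀ A i, E A * e i o = ∑ k, A k i • e k o := by
    intro A i
    simp only [e]
    rw [← hE.map_mul]
    have : A * Matrix.single i o (1 : ℂ) = ∑ k, A k i • Matrix.single k o (1 : ℂ) := by
      ext a b
      simp [Matrix.sum_apply, Matrix.mul_apply, Matrix.single_apply, ite_and]
    rw [this, hE.map_sum]
    exact Finset.sum_congr rfl fun k _ => hE.map_complex_smul hI _ _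
  -- the range of the projection `E |o⟩⟨o|` is the multiplicity space
  obtain ⟨m, V, hV, hV0, hmax⟩ := exists_isometry_ker (1 - e o o)
  have hVe : e o o * V = V := by
    rw [Matrix.sub_mul, Matrix.one_mul, sub_eq_zero] at hV0
    exact hV0.symm
  have hVV : V * Vᴴ = e o o := by
    have h1 := hmax (e o o) (by rw [Matrix.sub_mul, he, Matrix.one_mul, if_pos rfl, sub_self])
    have h2 : Vᴴ * e o o = Vᴴ := by
      have := congrArg Matrix.conjTranspose hVe
      rwa [Matrix.conjTranspose_mul, hes] at this
    rwa [h2] at h1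
  let W : Matrix N (κ × Fin m) ℂ := Matrix.of fun x p => (e p.1 o * V) x p.2
  have hW : ∀ x i j, W x (i, j) = (e i o * V) x j := fun _ _ _ => rfl
  have hWW : W * Wᴴ = 1 := by
    have h1 : W * Wᴴ = ∑ i, (e i o * V) * (e i o * V)ᴴ := by
      ext x y
      rw [Matrix.mul_apply, Fintype.sum_prod_type, Matrix.sum_apply]
      rfl
    rw [h1, ← hesum]
    refine Finset.sum_congr rfl fun i _ => ?_
    rw [Matrix.conjTranspose_mul, hes, Matrix.mul_assoc, ← Matrix.mul_assoc V, hVV, he,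
      if_pos rfl, he, if_pos rfl]
  have hW1 : Wᴴ * W = 1 := by
    ext ⟨i, p⟩ ⟨j, q⟩
    have h1 : (Wᴴ * W) (i, p) (j, q) = ((e i o * V)ᴴ * (e j o * V)) p q := rfl
    rw [h1, Matrix.conjTranspose_mul, hes, Matrix.mul_assoc, ← Matrix.mul_assoc (e o i), he]
    by_cases h : i = j
    · rw [if_pos h, hVe, hV]
      simp [Matrix.one_apply, h]
    · rw [if_neg h]
      simp [h]
  refine ⟨m, W, hW1, hWW, fun A => ?_⟩
  have hEW : E A * W = W * (A ⊗ₖ (1 : Matrix (Fin m) (Fin m) ℂ)) := by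
    ext x ⟨i, p⟩
    have h1 : (E A * W) x (i, p) = (E A * (e i o * V)) x p := rfl
    rw [h1, ← Matrix.mul_assoc, hEA, Matrix.sum_mul, Matrix.sum_apply, Matrix.mul_apply,
      Fintype.sum_prod_type]
    refine Finset.sum_congr rfl fun k _ => ?_
    simp [hW, Matrix.one_apply, mul_comm]
  rw [← hEW, Matrix.mul_assoc, hWW, Matrix.mul_one]

theorem eq_I_or_of_mul_self {c : ℂ} (hc : c * c = -1) : c = Complex.I ∨ c = -Complex.I := by
  rw [← mul_self_eq_mul_self_iff, hc, Complex.I_mul_I]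

/-! ### Standard encodings -/

section Standard

variable {κ κ' κ'' : Type*} [Fintype κ] [DecidableEq κ] [Fintype κ'] [DecidableEq κ']
  [Fintype κ''] [DecidableEq κ'']

/-- A map is an encoding if it becomes one after an injective encoding `L`. -/
theorem IsEncoding.of_comp {L : Matrix κ' κ' ℂ → Matrix κ'' κ'' ℂ} (hL : IsEncoding L)
    (hinj : Function.Injective L) {Z : Matrix κ κ ℂ → Matrix κ' κ' ℂ}
    (h : IsEncoding fun A => L (Z A)) : IsEncoding Z where
  map_one := hinj (by rw [h.map_one, hL.map_one])
  map_conjTranspose A := hinj (by rw [h.map_conjTranspose, hL.map_conjTranspose])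
  map_add A B := hinj (by rw [h.map_add, hL.map_add])
  map_mul A B := hinj (by rw [h.map_mul, hL.map_mul])
  map_real_smul x A := hinj (by rw [h.map_real_smul, hL.map_real_smul])

theorem isEncoding_submatrix {f : κ' → κ} (hf : Function.Bijective f) :
    IsEncoding fun A : Matrix κ κ ℂ => A.submatrix f f where
  map_one := Matrix.submatrix_one f hf.1
  map_conjTranspose _ := (Matrix.conjTranspose_submatrix _ _ _).symm
  map_add _ _ := rfl
  map_mul _ _ := Matrix.submatrix_mul _ _ _ _ _ hf
  map_real_smul _ _ := rfl

theorem isEncoding_kronecker_one :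
    IsEncoding fun A : Matrix κ κ ℂ => A ⊗ₖ (1 : Matrix κ' κ' ℂ) where
  map_one := Matrix.one_kronecker_one
  map_conjTranspose A := by rw [Matrix.conjTranspose_kronecker, Matrix.conjTranspose_one]
  map_add A B := Matrix.add_kronecker _ _ _
  map_mul A B := by rw [← Matrix.mul_kronecker_mul, Matrix.one_mul]
  map_real_smul x A := by ext i j; simp [mul_assoc]

theorem isEncoding_one_kronecker :
    IsEncoding fun A : Matrix κ κ ℂ => (1 : Matrix κ' κ' ℂ) ⊗ₖ A where
  map_one := Matrix.one_kronecker_one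
  map_conjTranspose A := by rw [Matrix.conjTranspose_kronecker, Matrix.conjTranspose_one]
  map_add A B := Matrix.kronecker_add _ _ _
  map_mul A B := by rw [← Matrix.mul_kronecker_mul, Matrix.one_mul]
  map_real_smul x A := by ext i j; simp [mul_left_comm]

theorem isEncoding_unitary_conj {U : Matrix κ' κ ℂ} (h1 : Uᴴ * U = 1) (h2 : U * Uᴴ = 1) :
    IsEncoding fun A : Matrix κ κ ℂ => U * A * Uᴴ where
  map_one := by rw [Matrix.mul_one, h2]
  map_conjTranspose A := by simp [Matrix.conjTranspose_mul, Matrix.mul_assoc]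
  map_add A B := by rw [Matrix.mul_add, Matrix.add_mul]
  map_mul A B := by
    have : U * A * Uᴴ * (U * B * Uᴴ) = U * (A * (Uᴴ * U) * B) * Uᴴ := by
      simp only [Matrix.mul_assoc]
    rw [this, h1, Matrix.mul_one]
  map_real_smul x A := by rw [Matrix.mul_smul, Matrix.smul_mul]

theorem isEncoding_localOp {ι : Type*} [Fintype ι] [DecidableEq ι] {κ : ι → Type*}
    [∀ i, Fintype (κ i)] [∀ i, DecidableEq (κ i)] (i : ι) :
    IsEncoding (localOp (κ := κ) i) where
  map_one := localOp_one i
  map_conjTranspose := localOp_conjTranspose i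
  map_add := localOp_add i
  map_mul := localOp_mul i
  map_real_smul x := localOp_smul x i

theorem isEncoding_blockDiagonal {o : Type*} [Fintype o] [DecidableEq o] {m : o → Type*}
    [∀ a, Fintype (m a)] [∀ a, DecidableEq (m a)] {B : ∀ a, Matrix κ κ ℂ → Matrix (m a) (m a) ℂ}
    (hB : ∀ a, IsEncoding (B a)) :
    IsEncoding fun A => Matrix.blockDiagonal' fun a => B a A where
  map_one := by
    simp only [(hB _).map_one]
    exact Matrix.blockDiagonal'_one
  map_conjTranspose A := by
    rw [Matrix.blockDiagonal'_conjTranspose]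
    simp only [(hB _).map_conjTranspose]
  map_add A A' := by
    rw [← Matrix.blockDiagonal'_add]
    congr 1
    ext1 a
    exact (hB a).map_add A A'
  map_mul A A' := by
    rw [← Matrix.blockDiagonal'_mul]
    congr 1
    ext1 a
    exact (hB a).map_mul A A'
  map_real_smul x A := by
    rw [← Matrix.blockDiagonal'_smul]
    congr 1
    ext1 a
    exact (hB a).map_real_smul x A

/-- Entrywise complex conjugation if `b` holds, and the identity otherwise. -/
def conjIf {κ : Type*} (b : Bool) (A : Matrix κ κ ℂ) : Matrix κ κ ℂ := if b then conjOp A else A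

theorem conjIf_conjIf {κ : Type*} (b : Bool) (A : Matrix κ κ ℂ) : conjIf b (conjIf b A) = A := by
  cases b
  · rfl
  · ext i j; simp [conjIf, conjOp]

theorem isEncoding_conjIf (b : Bool) : IsEncoding (conjIf (κ := κ) b) := by
  cases b
  · exact isEncoding_id
  · exact isEncoding_conjOp

end Standard

theorem conjIf_localOp {ι : Type*} [Fintype ι] [DecidableEq ι] {κ : ι → Type*}
    [∀ i, DecidableEq (κ i)] (b : Bool) (i : ι) (A : Matrix (κ i) (κ i) ℂ) :
    conjIf b (localOp i A) = localOp i (conjIf b A) := by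
  cases b
  · rfl
  · ext x y
    simp only [conjIf, conjOp, if_true, Matrix.map_apply, localOp_apply]
    split_ifs <;> simp

/-! ### Operators on one private region and the overlap -/

section Slice

/-- The block of `Z` at position `(u, v)`, for `Z` acting on a tensor product. -/
def slice {P C : Type*} (Z : Matrix (P × C) (P × C) ℂ) (u v : P) : Matrix C C ℂ :=
  Matrix.of fun a b => Z (u, a) (v, b)

variable {P C : Type*}

theorem slice_apply (Z : Matrix (P × C) (P × C) ℂ) (u v : P) (a b : C) :
    slice Z u v a b = Z (u, a) (v, b) := rfl

theorem ext_slice {Z Z' : Matrix (P × C) (P × C) ℂ} (h : ∀ u v, slice Z u v = slice Z' u v) :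
    Z = Z' := by
  ext ⟨u, a⟩ ⟨v, b⟩
  exact congrFun (congrFun (h u v) a) b

theorem slice_conjTranspose (Z : Matrix (P × C) (P × C) ℂ) (u v : P) :
    slice Zᴴ u v = (slice Z v u)ᴴ := rfl

theorem slice_add (Z Z' : Matrix (P × C) (P × C) ℂ) (u v : P) :
    slice (Z + Z') u v = slice Z u v + slice Z' u v := rfl

theorem slice_smul {R : Type*} [SMul R ℂ] (x : R) (Z : Matrix (P × C) (P × C) ℂ) (u v : P) :
    slice (x • Z) u v = x • slice Z u v := rfl

theorem slice_mul [Fintype P] [Fintype C] (Z Z' : Matrix (P × C) (P × C) ℂ) (u v : P) :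
    slice (Z * Z') u v = ∑ w, slice Z u w * slice Z' w v := by
  ext a b
  simp only [slice_apply, Matrix.mul_apply, Matrix.sum_apply, Fintype.sum_prod_type]

theorem slice_one [DecidableEq P] [DecidableEq C] (u v : P) :
    slice (1 : Matrix (P × C) (P × C) ℂ) u v = if u = v then 1 else 0 := by
  ext a b
  by_cases h : u = v <;> simp [slice_apply, Matrix.one_apply, h]

end Slice

section LiftOp

variable {ι : Type*} [Fintype ι] [DecidableEq ι] {C O : Type*} {P : ι → Type*}
  [DecidableEq O] [∀ i, DecidableEq (P i)]

/-- The operator `Z` on `P i ⊗ C`, extended by the identity to the other `P j` and to `O`. -/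
def liftOp (i : ι) (Z : Matrix (P i × C) (P i × C) ℂ) :
    Matrix (C × ((∀ i, P i) × O)) (C × ((∀ i, P i) × O)) ℂ :=
  (Z ⊗ₖ (1 : Matrix ((∀ j : {j // j ≠ i}, P j) × O) ((∀ j : {j // j ≠ i}, P j) × O) ℂ)).submatrix
    (fun x => ((x.2.1 i, x.1), (fun j => x.2.1 j, x.2.2)))
    (fun x => ((x.2.1 i, x.1), (fun j => x.2.1 j, x.2.2)))

theorem liftOp_apply (i : ι) (Z : Matrix (P i × C) (P i × C) ℂ) (x y : C × ((∀ i, P i) × O)) :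
    liftOp i Z x y = if (∀ j, j ≠ i → x.2.1 j = y.2.1 j) ∧ x.2.2 = y.2.2 then
      Z (x.2.1 i, x.1) (y.2.1 i, y.1) else 0 := by
  simp [liftOp, Matrix.one_apply, funext_iff]

theorem liftOp_bijective {ι : Type*} [DecidableEq ι] {C O : Type*} {P : ι → Type*} (i : ι) :
    Function.Bijective fun x : C × ((∀ i, P i) × O) =>
    (((x.2.1 i, x.1), ((fun j => x.2.1 j : ∀ j : {j // j ≠ i}, P j), x.2.2)) :
      (P i × C) × ((∀ j : {j // j ≠ i}, P j) × O)) := by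
  constructor
  · rintro ⟨a, p, o⟩ ⟨b, q, o'⟩ h
    simp only [Prod.mk.injEq, funext_iff, Subtype.forall] at h
    obtain ⟨⟨h1, rfl⟩, h2, rfl⟩ := h
    have : p = q := by
      ext1 j
      by_cases hj : j = i
      · subst hj; exact h1
      · exact h2 j hj
    rw [this]
  · rintro ⟨⟨u, a⟩, p, o⟩
    refine ⟨(a, (fun j => if h : j = i then h ▸ u else p ⟨j, h⟩, o)), ?_⟩
    simp only [Prod.mk.injEq, dite_true, true_and, and_true]
    ext1 ⟨j, hj⟩
    simp [hj]

theorem isEncoding_liftOp [Fintype C] [DecidableEq C] [Fintype O] [∀ i, Fintype (P i)] (i : ι) :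
    IsEncoding (liftOp (C := C) (O := O) (P := P) i) :=
  (isEncoding_submatrix (liftOp_bijective i)).comp isEncoding_kronecker_one

theorem liftOp_apply_update (i : ι) (Z : Matrix (P i × C) (P i × C) ℂ) (p : ∀ i, P i) (o : O)
    (u v : P i) (a b : C) :
    liftOp i Z (a, (Function.update p i u, o)) (b, (Function.update p i v, o)) = Z (u, a) (v, b) := by
  rw [liftOp_apply, if_pos ⟨fun j hj => by simp [hj], rfl⟩]
  simp

theorem liftOp_injective [Nonempty O] [∀ i, Nonempty (P i)] (i : ι) :
    Function.Injective (liftOp (C := C) (O := O) (P := P) i) := by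
  intro Z Z' h
  ext ⟨u, a⟩ ⟨v, b⟩
  have p : ∀ i, P i := fun i => Classical.arbitrary _
  have o : O := Classical.arbitrary _
  rw [← liftOp_apply_update i Z p o, h, liftOp_apply_update]

theorem liftOp_one_kronecker (i : ι) (Y : Matrix C C ℂ) :
    liftOp (O := O) i ((1 : Matrix (P i) (P i) ℂ) ⊗ₖ Y) = Y ⊗ₖ 1 := by
  ext ⟨a, p, o⟩ ⟨b, q, o'⟩
  rw [liftOp_apply]
  simp only [Matrix.kroneckerMap_apply, Matrix.one_apply, Prod.mk.injEq]
  have : (∀ j, j ≠ i → p j = q j) ∧ o = o' ∧ p i = q i ↔ p = q ∧ o = o' := by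
    refine ⟨fun h => ⟨funext fun j => ?_, h.2.1⟩, fun h => by simp [h.1, h.2]⟩
    by_cases hj : j = i
    · subst hj; exact h.2.2
    · exact h.1 j hj
  by_cases h : p = q ∧ o = o'
  · obtain ⟨h1, h2, h3⟩ := this.2 h
    simp [h.1, h.2]
  · rw [if_neg h, mul_zero]
    split_ifs with h1 h2
    · exact (h (this.1 ⟨h1.1, h1.2, h2⟩)).elim
    · simp
    · rfl

/-- Slices of commuting operators that share only the factor `C` commute. -/
theorem slice_commute [Fintype C] [Fintype O] [∀ i, Fintype (P i)] [Nonempty O]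
    [∀ i, Nonempty (P i)] {i j : ι} (hij : i ≠ j)
    {Z : Matrix (P i × C) (P i × C) ℂ} {Z' : Matrix (P j × C) (P j × C) ℂ}
    (h : Commute (liftOp (O := O) i Z) (liftOp j Z')) (u v : P i) (u' v' : P j) :
    Commute (slice Z u v) (slice Z' u' v') := by
  have key : ∀ {i j : ι} (_ : i ≠ j) (Z : Matrix (P i × C) (P i × C) ℂ)
      (Z' : Matrix (P j × C) (P j × C) ℂ) (p q : ∀ i, P i) (o : O) (a b : C),
      (∀ k, k ≠ i → k ≠ j → p k = q k) →
      (liftOp i Z * liftOp j Z' : Matrix (C × ((∀ i, P i) × O)) (C × ((∀ i, P i) × O)) ℂ)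
        (a, (p, o)) (b, (q, o)) =
        (slice Z (p i) (q i) * slice Z' (p j) (q j)) a b := by
    intro i j hij Z Z' p q o a b hpq
    rw [Matrix.mul_apply, Matrix.mul_apply, Fintype.sum_prod_type]
    refine Finset.sum_congr rfl fun c _ => ?_
    rw [Finset.sum_eq_single (Function.update p i (q i), o)]
    · rw [liftOp_apply, liftOp_apply, if_pos ⟨fun k hk => by simp [hk], rfl⟩, if_pos]
      · simp [slice_apply, hij.symm]
      · refine ⟨fun k hk => ?_, rfl⟩
        by_cases hki : k = i
        · subst hki; simp
        · simp [hki, hpq k hki hk]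
    · rintro ⟨r, o'⟩ - hne
      by_contra h0
      rw [liftOp_apply, liftOp_apply] at h0
      obtain ⟨h1, h2⟩ := ne_zero_and_ne_zero_of_mul h0
      have h1' := (ite_ne_right_iff.1 h1).1
      have h2' := (ite_ne_right_iff.1 h2).1
      refine hne (Prod.ext (funext fun k => ?_) h1'.2.symm)
      by_cases hki : k = i
      · subst hki
        simpa using h2'.1 k hij
      · simpa [hki] using (h1'.1 k hki).symm
    · simp
  have p₀ : ∀ i, P i := fun i => Classical.arbitrary _
  have o : O := Classical.arbitrary _
  let p := Function.update (Function.update p₀ i u) j u'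
  let q := Function.update (Function.update p₀ i v) j v'
  have hpi : p i = u := by simp [p, hij]
  have hpj : p j = u' := by simp [p]
  have hqi : q i = v := by simp [q, hij]
  have hqj : q j = v' := by simp [q]
  have hpq : ∀ k, k ≠ i → k ≠ j → p k = q k := fun k hi hj => by simp [p, q, hi, hj]
  ext a b
  have h1 := key hij Z Z' p q o a b hpq
  have h2 := key hij.symm Z' Z p q o a b fun k hj hi => hpq k hi hj
  rw [hpi, hpj, hqi, hqj] at h1 h2
  rw [← h1, ← h2, h.eq]

end LiftOp

/-! ### Simultaneous normal form of commuting encodings sharing an overlap -/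

theorem isEncoding_onBlock {n : ℕ} (l : ℕ) (k : Fin n → ℕ) (i : Fin n) :
    IsEncoding fun X : Matrix (Fin (k i)) (Fin (k i)) ℂ =>
      (1 : Matrix (Fin l) (Fin l) ℂ) ⊗ₖ localOp (κ := fun i => Fin (k i)) i X :=
  isEncoding_one_kronecker.comp (isEncoding_localOp (κ := fun i => Fin (k i)) i)

theorem onBlock_injective {n : ℕ} {l : ℕ} {k : Fin n → ℕ} (hl : 0 < l) (hk : ∀ i, 0 < k i)
    (i : Fin n) : Function.Injective fun X : Matrix (Fin (k i)) (Fin (k i)) ℂ =>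
      (1 : Matrix (Fin l) (Fin l) ℂ) ⊗ₖ localOp (κ := fun i => Fin (k i)) i X := by
  have : Nonempty (Fin l) := ⟨⟨0, hl⟩⟩
  have : ∀ i, Nonempty (Fin (k i)) := fun i => ⟨⟨0, hk i⟩⟩
  exact fun X Y h => localOp_injective i (one_kronecker_injective h)

/-- An operator that acts both on the factor `i` and on the factor `j ≠ i` only is a scalar. -/
theorem eq_smul_one_of_localOp_eq {ι : Type*} [Fintype ι] [DecidableEq ι] {κ : ι → Type*}
    [∀ i, DecidableEq (κ i)] [∀ i, Nonempty (κ i)] {i j : ι} (hij : i ≠ j)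
    {X : Matrix (κ i) (κ i) ℂ} {Y : Matrix (κ j) (κ j) ℂ} (h : localOp i X = localOp j Y) :
    ∃ c : ℂ, X = c • 1 := by
  let x : ∀ i, κ i := fun i => Classical.arbitrary _
  refine ⟨Y (x j) (x j), ?_⟩
  ext a b
  rw [← localOp_apply_update i X x, h, localOp_apply]
  by_cases hab : a = b
  · subst hab
    simp [hij.symm]
  · rw [if_neg fun h' => hab (by simpa using h' i hij)]
    simp [hab]

/-- The restriction of an encoding `Z` on `P ⊗ C` to an invariant summand `P ⊗ K` is again an
encoding. Here `F` embeds the summand into `C`, and `T` describes operators on the factor `K`. -/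
theorem IsEncoding.restrict {κ P C K B : Type} [Fintype κ] [DecidableEq κ] [Fintype P]
    [DecidableEq P] [Fintype C] [DecidableEq C] [Fintype K] [DecidableEq K] [Fintype B]
    [DecidableEq B] {Z : Matrix κ κ ℂ → Matrix (P × C) (P × C) ℂ} (hZ : IsEncoding Z)
    {F : Matrix C B ℂ} (hF : Fᴴ * F = 1) {T : Matrix K K ℂ → Matrix B B ℂ} (hT : IsEncoding T)
    (hinj : Function.Injective T) {p : Matrix κ κ ℂ → Matrix (P × K) (P × K) ℂ}
    (hp : ∀ A u v, slice (Z A) u v * F = F * T (slice (p A) u v)) : IsEncoding p := by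
  have huniq : ∀ (s : Matrix C C ℂ) X Y, s * F = F * T X → s * F = F * T Y → X = Y :=
    fun s X Y h1 h2 => hinj (eq_of_isometry_mul hF (h1.symm.trans h2))
  refine ⟨?_, fun A => ?_, fun A A' => ?_, fun A A' => ?_, fun x A => ?_⟩ <;>
    refine ext_slice fun u v => ?_
  · refine huniq _ _ _ (hp _ _ _) ?_
    rw [hZ.map_one, slice_one, slice_one]
    split_ifs
    · rw [hT.map_one, Matrix.one_mul, Matrix.mul_one]
    · rw [hT.map_zero, Matrix.zero_mul, Matrix.mul_zero]
  · refine hinj ?_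
    rw [slice_conjTranspose, hT.map_conjTranspose]
    refine conjTranspose_mul_isometry hF (hp A v u) ?_
    rw [← slice_conjTranspose, ← hZ.map_conjTranspose, hp]
  · refine huniq _ _ _ (hp _ _ _) ?_
    rw [hZ.map_add, slice_add, slice_add, Matrix.add_mul, hp, hp, hT.map_add, Matrix.mul_add]
  · refine huniq _ _ _ (hp _ _ _) ?_
    rw [hZ.map_mul, slice_mul, slice_mul, Matrix.sum_mul, hT.map_sum, Matrix.mul_sum]
    refine Finset.sum_congr rfl fun w _ => ?_
    rw [Matrix.mul_assoc, hp, ← Matrix.mul_assoc, hp, Matrix.mul_assoc, hT.map_mul]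
  · refine huniq _ _ _ (hp _ _ _) ?_
    rw [hZ.map_real_smul, slice_smul, slice_smul, Matrix.smul_mul, hp, hT.map_real_smul,
      Matrix.mul_smul]

/-- An encoding that maps `i 1` to a scalar is, up to a unitary, either `A ↦ A ⊗ 1` or
`A ↦ Ā ⊗ 1`. -/
theorem IsEncoding.exists_unitary_of_map_I_smul {κ N : Type} [Fintype κ] [DecidableEq κ]
    [Nonempty κ] [Fintype N] [DecidableEq N] {E : Matrix κ κ ℂ → Matrix N N ℂ} (hE : IsEncoding E)
    (b : Bool) (hI : E (Complex.I • 1) = (if b then -Complex.I else Complex.I) • 1) :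
    ∃ (m : ℕ) (W : Matrix N (κ × Fin m) ℂ), Wᴴ * W = 1 ∧ W * Wᴴ = 1 ∧
      ∀ A, E A = W * (conjIf b A ⊗ₖ (1 : Matrix (Fin m) (Fin m) ℂ)) * Wᴴ := by
  have h1 : E (conjIf b (Complex.I • 1)) = Complex.I • 1 := by
    cases b
    · simpa [conjIf] using hI
    · have : conjOp (Complex.I • 1 : Matrix κ κ ℂ) = -(Complex.I • 1) := by
        ext i j
        by_cases h : i = j <;> simp [conjOp, h]
      simp only [conjIf, if_true]
      rw [this, hE.map_neg, hI]
      simp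
  obtain ⟨m, W, hW1, hW2, hW⟩ :=
    (hE.comp (isEncoding_conjIf b)).exists_unitary_of_map_I h1
  refine ⟨m, W, hW1, hW2, fun A => ?_⟩
  rw [← hW (conjIf b A), Function.comp_apply, conjIf_conjIf]

theorem IsOrthoSum.reindex {ι ι' N : Type} [Fintype ι] [Fintype ι'] [Fintype N] [DecidableEq N]
    {κ : ι → Type} [∀ a, Fintype (κ a)] [∀ a, DecidableEq (κ a)] {F : ∀ a, Matrix N (κ a) ℂ}
    (hF : IsOrthoSum F) (e : ι' ≃ ι) : IsOrthoSum fun a => F (e a) where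
  isometry a := hF.isometry _
  ortho a b h := hF.ortho _ _ fun h' => h (e.injective h')
  sum_eq_one := by rw [← hF.sum_eq_one]; exact e.sum_comp fun a => F a * (F a)ᴴ

/-- Encodings `Z i` on `P i ⊗ C` that commute with each other and agree on the imaginary unit are
simultaneously block-diagonal on the shared factor `C`. On each block `ℂ^l ⊗ ⨂ i, ℂ^(k i)` the
encoding `Z i` acts on `P i ⊗ ℂ^(k i)` only, where it is unitarily equivalent to `A ↦ A ⊗ 1` for
all `i`, or to `A ↦ Ā ⊗ 1` for all `i`. -/
theorem exists_normal_form {n : ℕ} (hn : 2 ≤ n) {d : Fin n → ℕ} (hd : ∀ i, 0 < d i)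
    {C O : Type} {P : Fin n → Type} [Fintype C] [DecidableEq C] [Fintype O] [DecidableEq O]
    [Nonempty O] [∀ i, Fintype (P i)] [∀ i, DecidableEq (P i)] [∀ i, Nonempty (P i)]
    {Z : ∀ i, Matrix (Fin (d i)) (Fin (d i)) ℂ → Matrix (P i × C) (P i × C) ℂ}
    (hZ : ∀ i, IsEncoding (Z i))
    (hcomm : ∀ i j, i ≠ j → ∀ A B, Commute (liftOp (O := O) i (Z i A)) (liftOp j (Z j B)))
    (hI : ∀ i j, liftOp (O := O) i (Z i (Complex.I • 1)) = liftOp j (Z j (Complex.I • 1))) :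
    ∃ (r : ℕ) (l : Fin r → ℕ) (k : Fin r → Fin n → ℕ)
      (F : ∀ a, Matrix C (Fin (l a) × ∀ i, Fin (k a i)) ℂ) (b : Fin r → Bool)
      (m : Fin r → Fin n → ℕ)
      (W : ∀ a i, Matrix (P i × Fin (k a i)) (Fin (d i) × Fin (m a i)) ℂ),
      IsOrthoSum F ∧ (∀ a i, (W a i)ᴴ * W a i = 1) ∧ (∀ a i, W a i * (W a i)ᴴ = 1) ∧
      ∀ i A u v a, slice (Z i A) u v * F a =
        F a * ((1 : Matrix (Fin (l a)) (Fin (l a)) ℂ) ⊗ₖ localOp (κ := fun i => Fin (k a i)) i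
          (slice (W a i * (conjIf (b a) A ⊗ₖ (1 : Matrix (Fin (m a i)) (Fin (m a i)) ℂ)) *
            (W a i)ᴴ) u v)) := by
  classical
  have (i : Fin n) : Nonempty (Fin (d i)) := ⟨⟨0, hd i⟩⟩
  obtain ⟨ι, _, l, k, F, hF, hl, hk, hact⟩ := exists_joint_decomposition n
    (fun i => {s | ∃ A u v, s = slice (Z i A) u v})
    (by
      rintro i _ ⟨A, u, v, rfl⟩
      exact ⟨Aᴴ, v, u, by rw [(hZ i).map_conjTranspose, slice_conjTranspose]⟩)
    (by
      rintro i j hij _ ⟨A, u, v, rfl⟩ _ ⟨B, u', v', rfl⟩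
      exact slice_commute hij (hcomm i j hij A B) u v u' v')
  let e := (Fintype.equivFin ι).symm
  have hact' : ∀ i A u v a, ∃ X : Matrix (Fin (k a i)) (Fin (k a i)) ℂ,
      slice (Z i A) u v * F a = F a * ((1 : Matrix (Fin (l a)) (Fin (l a)) ℂ) ⊗ₖ
        localOp (κ := fun i => Fin (k a i)) i X) :=
    fun i A u v a => hact i _ ⟨A, u, v, rfl⟩ a
  choose X hX using hact'
  let p : ∀ a i, Matrix (Fin (d i)) (Fin (d i)) ℂ →
      Matrix (P i × Fin (k a i)) (P i × Fin (k a i)) ℂ :=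
    fun a i A => Matrix.of fun x y => X i A x.1 y.1 a x.2 y.2
  have hp : ∀ a i A u v, slice (Z i A) u v * F a = F a * ((1 : Matrix (Fin (l a)) (Fin (l a)) ℂ) ⊗ₖ
      localOp (κ := fun i => Fin (k a i)) i (slice (p a i A) u v)) :=
    fun a i A u v => hX i A u v a
  have hpE : ∀ a i, IsEncoding (p a i) := fun a i =>
    (hZ i).restrict (hF.isometry a) (isEncoding_onBlock (l a) (k a) i)
      (onBlock_injective (hl a) (hk a) i) (hp a i)
  -- the image of the imaginary unit acts on `C` only
  let i₀ : Fin n := ⟨0, by omega⟩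
  let i₁ : Fin n := ⟨1, by omega⟩
  have hi₀₁ : i₀ ≠ i₁ := by simp [i₀, i₁]
  let w : ∀ i, P i := fun i => Classical.arbitrary _
  let o : O := Classical.arbitrary O
  have hsl : ∀ i j, i ≠ j → ∀ u v, slice (Z i (Complex.I • 1)) u v =
      if u = v then slice (Z j (Complex.I • 1)) (w j) (w j) else 0 := by
    intro i j hij u v
    ext x y
    rw [slice_apply, ← liftOp_apply_update i (Z i (Complex.I • 1)) w o, hI i j, liftOp_apply]
    by_cases huv : u = v
    · subst huv
      simp [hij.symm, slice_apply]
    · rw [if_neg fun h => huv (by simpa using h.1 i hij), if_neg huv]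
      rfl
  obtain ⟨J, hJ⟩ : ∃ J : Matrix C C ℂ, ∀ i u v,
      slice (Z i (Complex.I • 1)) u v = if u = v then J else 0 := by
    refine ⟨slice (Z i₀ (Complex.I • 1)) (w i₀) (w i₀), fun i u v => ?_⟩
    by_cases hi : i = i₀
    · subst hi
      rw [hsl i₀ i₁ hi₀₁, hsl i₀ i₁ hi₀₁, if_pos rfl]
    · rw [hsl i i₀ hi]
  have hJJ : J * J = -1 := by
    have h1 : slice (Z i₀ (Complex.I • 1) * Z i₀ (Complex.I • 1)) (w i₀) (w i₀) = J * J := by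
      rw [slice_mul]
      simp [hJ]
    rw [← h1, ← (hZ i₀).map_mul, Matrix.smul_mul, Matrix.one_mul, smul_smul, Complex.I_mul_I,
      neg_one_smul, (hZ i₀).map_neg, (hZ i₀).map_one]
    ext x y
    simp [slice_apply, Matrix.one_apply]
  -- since it acts on the two distinct factors `i₀` and `i₁` of each block, it is a scalar there
  have hscal : ∀ a, ∃ c : ℂ, J * F a = c • F a ∧ c * c = -1 := by
    intro a
    have (i : Fin n) : Nonempty (Fin (k a i)) := ⟨⟨0, hk a i⟩⟩
    have : Nonempty (Fin (l a)) := ⟨⟨0, hl a⟩⟩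
    have h : ∀ i, J * F a = F a * ((1 : Matrix (Fin (l a)) (Fin (l a)) ℂ) ⊗ₖ
        localOp (κ := fun i => Fin (k a i)) i (slice (p a i (Complex.I • 1)) (w i) (w i))) := by
      intro i
      rw [← hp, hJ, if_pos rfl]
    obtain ⟨c, hc⟩ := eq_smul_one_of_localOp_eq hi₀₁ (one_kronecker_injective
      (eq_of_isometry_mul (hF.isometry a) ((h i₀).symm.trans (h i₁))))
    have hcF : J * F a = c • F a := by
      rw [h i₀, hc, localOp_smul, localOp_one, Matrix.kronecker_smul, Matrix.one_kronecker_one,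
        Matrix.mul_smul, Matrix.mul_one]
    refine ⟨c, hcF, ?_⟩
    have h2 : (c * c) • F a = (-1 : ℂ) • F a := by
      rw [mul_smul, ← hcF, ← Matrix.mul_smul, ← hcF, ← Matrix.mul_assoc, hJJ]
      simp
    have h3 := congrArg ((F a)ᴴ * ·) h2
    simp only [Matrix.mul_smul, hF.isometry] at h3
    let x : Fin (l a) × ∀ i, Fin (k a i) := Classical.arbitrary _
    simpa using congrFun (congrFun h3 x) x
  have hbool : ∀ a, ∃ b : Bool, J * F a = (if b then -Complex.I else Complex.I) • F a := by
    intro a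
    obtain ⟨c, hc, hcc⟩ := hscal a
    rcases eq_I_or_of_mul_self hcc with rfl | rfl
    · exact ⟨false, by simpa using hc⟩
    · exact ⟨true, by simpa using hc⟩
  choose b hb using hbool
  have hpI : ∀ a i, p a i (Complex.I • 1) = (if b a then -Complex.I else Complex.I) • 1 := by
    intro a i
    refine ext_slice fun u v => onBlock_injective (hl a) (hk a) i
      (eq_of_isometry_mul (hF.isometry a) ?_)
    simp only
    rw [← hp, hJ, slice_smul, slice_one]
    by_cases huv : u = v
    · rw [if_pos huv, if_pos huv, hb, localOp_smul, localOp_one, Matrix.kronecker_smul,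
        Matrix.one_kronecker_one, Matrix.mul_smul, Matrix.mul_one]
    · rw [if_neg huv, if_neg huv, smul_zero, (isEncoding_onBlock (l a) (k a) i).map_zero,
        Matrix.zero_mul, Matrix.mul_zero]
  choose m W hW1 hW2 hW using fun a i => (hpE a i).exists_unitary_of_map_I_smul (b a) (hpI a i)
  refine ⟨Fintype.card ι, fun a => l (e a), fun a => k (e a), fun a => F (e a), fun a => b (e a),
    fun a => m (e a), fun a => W (e a), hF.reindex e, fun a => hW1 (e a), fun a => hW2 (e a),
    fun i A u v a => ?_⟩
  rw [← hW]
  exact hp (e a) i A u v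

/-! ### The overlap, the private regions and the outside -/

section Regions

variable {n n' : ℕ} {d' : Fin n' → ℕ} {S : Fin n → Finset (Fin n')}

theorem mem_overlap {k : Fin n'} : k ∈ overlap S ↔ ∃ i j, i ≠ j ∧ k ∈ S i ∧ k ∈ S j := by
  simp [overlap]

theorem mem_priv {i : Fin n} {k : Fin n'} : k ∈ priv S i ↔ k ∈ S i ∧ k ∉ overlap S := by
  simp [priv]

theorem mem_outside {k : Fin n'} : k ∈ outside S ↔ ∀ i, k ∉ S i := by
  simp [outside]

theorem eq_of_mem_of_notMem_overlap {k : Fin n'} (hk : k ∉ overlap S) {i j : Fin n} (hi : k ∈ S i)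
    (hj : k ∈ S j) : i = j := by
  by_contra h
  exact hk (mem_overlap.2 ⟨i, j, h, hi, hj⟩)

/-- The parts of a label of the simulator in the overlap, the private regions and the outside. -/
def splitCfg (S : Fin n → Finset (Fin n')) (x : Cfg d') : Cfg (fun k : overlap S => d' k) ×
    ((∀ i, Cfg fun k : priv S i => d' k) × Cfg fun k : outside S => d' k) :=
  (res (overlap S) x, (fun i => res (priv S i) x, res (outside S) x))

theorem splitCfg_bijective : Function.Bijective (splitCfg (d' := d') S) := by
  classical
  constructor
  · intro x y h
    simp only [splitCfg, Prod.mk.injEq, funext_iff, res, Subtype.forall] at h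
    ext1 k
    by_cases h0 : k ∈ overlap S
    · exact h.1 k h0
    · by_cases hi : ∃ i, k ∈ S i
      · obtain ⟨i, hi⟩ := hi
        exact h.2.1 i k (mem_priv.2 ⟨hi, h0⟩)
      · exact h.2.2 k (mem_outside.2 fun i h' => hi ⟨i, h'⟩)
  · rintro ⟨a, p, o⟩
    refine ⟨fun k => if h0 : k ∈ overlap S then a ⟨k, h0⟩ else
      if hi : ∃ i, k ∈ S i then p hi.choose ⟨k, mem_priv.2 ⟨hi.choose_spec, h0⟩⟩ else
        o ⟨k, mem_outside.2 fun i h' => hi ⟨i, h'⟩⟩, ?_⟩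
    refine Prod.ext (funext fun ⟨k, hk⟩ => ?_) (Prod.ext (funext fun i => funext fun ⟨k, hk⟩ => ?_)
      (funext fun ⟨k, hk⟩ => ?_))
    · simp [splitCfg, res, hk]
    · have hk' := mem_priv.1 hk
      have hi : ∃ i, k ∈ S i := ⟨i, hk'.1⟩
      have hii : hi.choose = i := eq_of_mem_of_notMem_overlap hk'.2 hi.choose_spec hk'.1
      simp only [splitCfg, res]
      rw [dif_neg hk'.2, dif_pos hi]
      have : ∀ (j : Fin n) (hj : k ∈ priv S j), j = i → p j ⟨k, hj⟩ = p i ⟨k, hk⟩ := by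
        rintro j hj rfl
        rfl
      exact this _ _ hii
    · have hk' := mem_outside.1 hk
      have h0 : k ∉ overlap S := fun h => by
        obtain ⟨i, _, _, hi, _⟩ := mem_overlap.1 h
        exact hk' i hi
      have hi : ¬ ∃ i, k ∈ S i := fun ⟨i, hi⟩ => hk' i hi
      simp only [splitCfg, res]
      rw [dif_neg h0, dif_neg hi]

theorem extendOp_overlap (Y : Op fun k : overlap S => d' k) :
    extendOp (overlap S) Y = (Y ⊗ₖ 1).submatrix (splitCfg S) (splitCfg S) := by
  ext x y
  rw [extendOp_apply, Matrix.submatrix_apply, Matrix.kroneckerMap_apply, Matrix.one_apply]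
  have : (∀ j, j ∉ overlap S → x j = y j) ↔ (splitCfg S x).2 = (splitCfg S y).2 := by
    simp only [splitCfg, Prod.mk.injEq, funext_iff, res, Subtype.forall]
    refine ⟨fun h => ⟨fun i k hk => h k (mem_priv.1 hk).2, fun k hk => h k fun h0 => ?_⟩,
      fun h k hk => ?_⟩
    · obtain ⟨i, _, _, hi, _⟩ := mem_overlap.1 h0
      exact mem_outside.1 hk i hi
    · by_cases hi : ∃ i, k ∈ S i
      · obtain ⟨i, hi⟩ := hi
        exact h.1 i k (mem_priv.2 ⟨hi, hk⟩)
      · exact h.2 k (mem_outside.2 fun i h' => hi ⟨i, h'⟩)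
  by_cases h : (splitCfg S x).2 = (splitCfg S y).2
  · rw [if_pos h, if_pos (this.2 h), mul_one]; rfl
  · rw [if_neg h, if_neg fun h' => h (this.1 h'), mul_zero]

/-- An operator on `S i` acts on the private region `i` and the overlap only. -/
theorem ActsOnlyOn.exists_liftOp {i : Fin n} {X : Op d'} (hX : ActsOnlyOn (S i) X) :
    ∃ Z, X = (liftOp (C := Cfg fun k : overlap S => d' k) (O := Cfg fun k : outside S => d' k)
      (P := fun i => Cfg fun k : priv S i => d' k) i Z).submatrix (splitCfg S) (splitCfg S) := by
  have hsub : S i ⊆ priv S i ∪ overlap S := fun k hk => by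
    by_cases h0 : k ∈ overlap S
    · exact Finset.mem_union_right _ h0
    · exact Finset.mem_union_left _ (mem_priv.2 ⟨hk, h0⟩)
  obtain ⟨Y, rfl⟩ := hX.mono hsub
  let g : (Cfg fun k : priv S i => d' k) × (Cfg fun k : overlap S => d' k) →
      Cfg fun k : (priv S i ∪ overlap S : Finset (Fin n')) => d' k := fun q k =>
    if h : (k : Fin n') ∈ overlap S then q.2 ⟨k, h⟩ else
      q.1 ⟨k, (Finset.mem_union.1 k.2).resolve_right h⟩
  have hg : ∀ x : Cfg d', res (priv S i ∪ overlap S) x = g (res (priv S i) x, res (overlap S) x) := by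
    intro x
    ext1 k
    simp only [g, res]
    split_ifs <;> rfl
  refine ⟨Matrix.of fun q q' => Y (g q) (g q'), ?_⟩
  ext x y
  rw [extendOp_apply, Matrix.submatrix_apply, liftOp_apply, Matrix.of_apply, hg, hg]
  have key : (∀ k, k ∉ priv S i ∪ overlap S → x k = y k) ↔
      (∀ j, j ≠ i → (splitCfg S x).2.1 j = (splitCfg S y).2.1 j) ∧
        (splitCfg S x).2.2 = (splitCfg S y).2.2 := by
    refine ⟨fun h => ⟨fun j hj => funext fun k => h k ?_, funext fun k => h k ?_⟩,
      fun h k hk => ?_⟩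
    · have hk := mem_priv.1 k.2
      simp only [Finset.mem_union, not_or]
      exact ⟨fun h' => hj (eq_of_mem_of_notMem_overlap hk.2 hk.1 (mem_priv.1 h').1), hk.2⟩
    · have hk := mem_outside.1 k.2
      simp only [Finset.mem_union, not_or]
      refine ⟨fun h' => hk i (mem_priv.1 h').1, fun h' => ?_⟩
      obtain ⟨i, _, _, hi, _⟩ := mem_overlap.1 h'
      exact hk i hi
    · simp only [Finset.mem_union, not_or] at hk
      by_cases hj : ∃ j, k ∈ S j
      · obtain ⟨j, hj⟩ := hj
        have hji : j ≠ i := by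
          rintro rfl
          exact hk.1 (mem_priv.2 ⟨hj, hk.2⟩)
        exact congrFun (h.1 j hji) ⟨k, mem_priv.2 ⟨hj, hk.2⟩⟩
      · exact congrFun h.2 ⟨k, mem_outside.2 fun j h' => hj ⟨j, h'⟩⟩
  by_cases h : ∀ k, k ∉ priv S i ∪ overlap S → x k = y k
  · rw [if_pos h, if_pos (key.1 h)]
    rfl
  · rw [if_neg h, if_neg fun h' => h (key.2 h')]

end Regions

/-! ### The block form is an encoding -/

section BlockForm

variable {n n' : ℕ} {d : Fin n → ℕ} {d' : Fin n' → ℕ} {S : Fin n → Finset (Fin n')}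

theorem Decomposition.regroup_bijective (D : Decomposition d d' S) :
    Function.Bijective D.regroup := by
  let f₀ : ((Σ a : Fin D.r, Fin (D.dE00 a) × (∀ i, Fin (D.dE0 a i))) × (∀ i, Fin (D.dIn i))) →
      ((∀ i, Cfg fun k : priv S i => d' k) × Cfg fun k : outside S => d' k) → Σ a, D.Blk a :=
    fun q x => ⟨q.1.1, q.1.2.1, fun i => ((D.site i).symm (q.2 i, (D.privEquiv i (x.1 i)).2),
      ((D.privEquiv i (x.1 i)).1, q.1.2.2 i)), x.2⟩
  let f : (Cfg (fun k : overlap S => d' k) ×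
      ((∀ i, Cfg fun k : priv S i => d' k) × Cfg fun k : outside S => d' k)) → Σ a, D.Blk a :=
    fun x => f₀ (D.overlapEquiv x.1) x.2
  let g : (Σ a, D.Blk a) → (Cfg (fun k : overlap S => d' k) ×
      ((∀ i, Cfg fun k : priv S i => d' k) × Cfg fun k : outside S => d' k)) :=
    fun y => (D.overlapEquiv.symm (⟨y.1, y.2.1, fun i => (y.2.2.1 i).2.2⟩,
      fun i => (D.site i (y.2.2.1 i).1).1),
      (fun i => (D.privEquiv i).symm ((y.2.2.1 i).2.1, (D.site i (y.2.2.1 i).1).2), y.2.2.2))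
  have hf : Function.Bijective f := by
    refine Function.bijective_iff_has_inverse.2 ⟨g, fun x => ?_, fun y => ?_⟩
    · simp [f, f₀, g]
    · obtain ⟨a, s, q, o⟩ := y
      simp only [f, g]
      rw [Equiv.apply_symm_apply]
      simp [f₀]
  exact hf.comp splitCfg_bijective

theorem tensorOp_unitary {ι : Type*} [Fintype ι] [DecidableEq ι] {κ : ι → Type*}
    [∀ i, Fintype (κ i)] [∀ i, DecidableEq (κ i)] {U : ∀ i, Matrix (κ i) (κ i) ℂ}
    (hU : ∀ i, (U i)ᴴ * U i = 1) : (tensorOp U)ᴴ * tensorOp U = 1 := by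
  rw [tensorOp_conjTranspose, tensorOp_mul]
  simp only [hU]
  exact tensorOp_one

theorem isEncoding_blockForm (D : Decomposition d d' S)
    {U₀ : Matrix (Cfg fun k : overlap S => d' k) (Cfg fun k : overlap S => d' k) ℂ}
    (hU₀ : U₀ᴴ * U₀ = 1) {U : ∀ a i, Matrix (D.Loc a i) (D.Loc a i) ℂ}
    (hU : ∀ a i, (U a i)ᴴ * U a i = 1) (b : Fin D.r → Bool) :
    IsEncoding fun M : Op d => extendOp (overlap S) U₀ *
      D.directSum (fun a => D.block a (U a) (conjIf (b a) M)) * (extendOp (overlap S) U₀)ᴴ := by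
  -- the instances that the encodings built from Kronecker products carry
  let _ : ∀ a, DecidableEq ((∀ i, D.Loc a i) × Cfg fun k : outside S => d' k) :=
    fun a => instDecidableEqProd
  let _ : ∀ a, DecidableEq (D.Blk a) := fun a => instDecidableEqProd
  have hV : (extendOp (overlap S) U₀)ᴴ * extendOp (overlap S) U₀ = 1 := by
    rw [extendOp_conjTranspose, ← extendOp_mul, hU₀, extendOp_one]
  have hampl : ∀ a, IsEncoding (D.ampl a) := fun a => by
    refine (isEncoding_submatrix (f := fun x : ∀ i, D.Loc a i =>
      ((fun i => (x i).1 : Cfg d), fun i => (x i).2)) ?_).comp isEncoding_kronecker_one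
    refine Function.bijective_iff_has_inverse.2 ⟨fun y i => (y.1 i, y.2 i), ?_, ?_⟩ <;>
      exact fun _ => rfl
  have hblock : ∀ a, IsEncoding fun M => D.block a (U a) (conjIf (b a) M) := fun a => by
    have hT := tensorOp_unitary (hU a)
    have h := ((isEncoding_one_kronecker (κ' := Fin (D.dE00 a))).comp
      ((isEncoding_kronecker_one (κ' := Cfg fun k : outside S => d' k)).comp
        ((isEncoding_unitary_conj hT (mul_eq_one_comm.1 hT)).comp
          (hampl a)))).comp (isEncoding_conjIf (b a))
    exact h
  exact (isEncoding_unitary_conj hV (mul_eq_one_comm.1 hV)).comp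
    ((isEncoding_submatrix D.regroup_bijective).comp (isEncoding_blockDiagonal hblock))

theorem Decomposition.ampl_onSite (D : Decomposition d d' S) (a : Fin D.r) (i : Fin n)
    (A : Matrix (Fin (d i)) (Fin (d i)) ℂ) :
    D.ampl a (onSite i A) = localOp (κ := D.Loc a) i
      (A ⊗ₖ (1 : Matrix (Fin (D.dE i) × Fin (D.dE0 a i)) (Fin (D.dE i) × Fin (D.dE0 a i)) ℂ)) := by
  ext x y
  rw [ampl, Matrix.submatrix_apply, Matrix.kroneckerMap_apply, onSite_eq_localOp, localOp_apply,
    localOp_apply, Matrix.kroneckerMap_apply, Matrix.one_apply, Matrix.one_apply]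
  simp only [funext_iff]
  by_cases h : ∀ j, j ≠ i → x j = y j
  · have h1 : ∀ j, j ≠ i → (x j).1 = (y j).1 := fun j hj => by rw [h j hj]
    rw [if_pos h, if_pos h1]
    have h2 : (∀ j, (x j).2 = (y j).2) ↔ (x i).2 = (y i).2 := by
      refine ⟨fun h' => h' i, fun h' j => ?_⟩
      by_cases hj : j = i
      · rw [hj, h']
      · rw [h j hj]
    simp only [h2]
  · rw [if_neg h]
    by_cases h1 : ∀ j, j ≠ i → (x j).1 = (y j).1
    · rw [if_neg (c := ∀ j, (x j).2 = (y j).2) fun h2 =>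
        h fun j hj => Prod.ext (h1 j hj) (h2 j), mul_zero]
    · rw [if_neg h1, zero_mul]

theorem tensorOp_conj_localOp {ι : Type*} [Fintype ι] [DecidableEq ι] {κ : ι → Type*}
    [∀ i, Fintype (κ i)] [∀ i, DecidableEq (κ i)] {U : ∀ i, Matrix (κ i) (κ i) ℂ}
    (hU : ∀ i, U i * (U i)ᴴ = 1) (i : ι) (A : Matrix (κ i) (κ i) ℂ) :
    tensorOp U * localOp i A * (tensorOp U)ᴴ = localOp i (U i * A * (U i)ᴴ) := by
  rw [localOp, localOp, tensorOp_conjTranspose, tensorOp_mul, tensorOp_mul]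
  congr 1
  ext1 j
  by_cases hj : j = i
  · subst hj; simp
  · simp [hj, hU]

end BlockForm

/-! ### Matching dimensions -/

/-- If `p * k = d * m`, then splitting off the common factor `gcd d p` from `d` and `p` leaves a
factor of `d` that divides `k`. -/
theorem dvd_of_mul_eq_mul {d p k m : ℕ} (hd : 0 < d) (h : p * k = d * m) :
    d / d.gcd p ∣ k := by
  have hg : 0 < d.gcd p := Nat.gcd_pos_of_pos_left _ hd
  have hcop := Nat.coprime_div_gcd_div_gcd hg
  have hdvd : d / d.gcd p ∣ p / d.gcd p * k := ⟨m, ?_⟩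
  · exact hcop.dvd_of_dvd_mul_left hdvd
  refine Nat.eq_of_mul_eq_mul_left hg ?_
  rw [← mul_assoc, ← mul_assoc, Nat.mul_div_cancel' (Nat.gcd_dvd_left d p),
    Nat.mul_div_cancel' (Nat.gcd_dvd_right d p), h]

theorem card_eq_of_unitary {M N : Type} [Fintype M] [DecidableEq M] [Fintype N] [DecidableEq N]
    {W : Matrix M N ℂ} (h1 : Wᴴ * W = 1) (h2 : W * Wᴴ = 1) : Fintype.card M = Fintype.card N := by
  refine le_antisymm (card_le_of_isometry (F := Wᴴ) ?_) (card_le_of_isometry h1)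
  rw [Matrix.conjTranspose_conjTranspose, h2]

/-! ### Assembling the decomposition -/

/-- The isometries of an orthogonal direct sum, joined into one matrix. -/
def joinIsometries {ι N : Type} {κ : ι → Type} (F : ∀ a, Matrix N (κ a) ℂ) :
    Matrix N (Σ a, κ a) ℂ :=
  Matrix.of fun x y => F y.1 x y.2

section Join

variable {ι N : Type} [Fintype ι] [Fintype N] {κ : ι → Type} [∀ a, Fintype (κ a)]
  {F : ∀ a, Matrix N (κ a) ℂ}

theorem IsOrthoSum.join_isometry [DecidableEq ι] [DecidableEq N] [∀ a, DecidableEq (κ a)]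
    (hF : IsOrthoSum F) :
    (joinIsometries F)ᴴ * joinIsometries F = 1 := by
  ext ⟨a, x⟩ ⟨b, y⟩
  have h : ((joinIsometries F)ᴴ * joinIsometries F) ⟨a, x⟩ ⟨b, y⟩ = ((F a)ᴴ * F b) x y := rfl
  rw [h]
  by_cases hab : a = b
  · subst hab
    rw [hF.isometry, Matrix.one_apply, Matrix.one_apply]
    simp
  · rw [hF.ortho a b hab, Matrix.one_apply_ne]
    · rfl
    · intro h'
      exact hab (congrArg Sigma.fst h')

theorem IsOrthoSum.join_coisometry [DecidableEq N] [∀ a, DecidableEq (κ a)]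
    (hF : IsOrthoSum F) :
    joinIsometries F * (joinIsometries F)ᴴ = 1 := by
  rw [← hF.sum_eq_one]
  ext x y
  rw [Matrix.mul_apply, Fintype.sum_sigma, Matrix.sum_apply]
  rfl

theorem mul_joinIsometries [DecidableEq ι] {s : Matrix N N ℂ} {B : ∀ a, Matrix (κ a) (κ a) ℂ}
    (h : ∀ a, s * F a = F a * B a) :
    s * joinIsometries F = joinIsometries F * Matrix.blockDiagonal' B := by
  ext x ⟨a, y⟩
  have h1 : (s * joinIsometries F) x ⟨a, y⟩ = (s * F a) x y := rfl
  rw [h1, h, Matrix.mul_apply, Matrix.mul_apply, Fintype.sum_sigma, Finset.sum_eq_single a]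
  · simp [joinIsometries]
  · intro b _ hb
    refine Finset.sum_eq_zero fun z _ => ?_
    rw [Matrix.blockDiagonal'_apply_ne _ _ _ hb, mul_zero]
  · simp

end Join

theorem submatrix_injective {M N : Type*} {f : M → N} (hf : Function.Surjective f) :
    Function.Injective fun A : Matrix N N ℂ => A.submatrix f f := by
  intro A B h
  ext x y
  obtain ⟨x, rfl⟩ := hf x
  obtain ⟨y, rfl⟩ := hf y
  exact congrFun (congrFun h x) y

section Assemble

variable {n n' : ℕ} {d : Fin n → ℕ} {d' : Fin n' → ℕ} {S : Fin n → Finset (Fin n')}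

/-- The regrouping `H_{Q_i} ⊗ K ≃ H_i ⊗ E_i ⊗ E_{0.i}^α`, given `K ≃ E_{0.i}^α ⊗ H_i^in`. -/
def Decomposition.locEquiv (D : Decomposition d d' S) (a : Fin D.r) (i : Fin n) {k : ℕ}
    (e : Fin k ≃ Fin (D.dE0 a i) × Fin (D.dIn i)) :
    (Cfg fun k : priv S i => d' k) × Fin k ≃ D.Loc a i where
  toFun x := ((D.site i).symm ((e x.2).2, (D.privEquiv i x.1).2),
    ((D.privEquiv i x.1).1, (e x.2).1))
  invFun y := ((D.privEquiv i).symm (y.2.1, (D.site i y.1).2), e.symm (y.2.2, (D.site i y.1).1))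
  left_inv x := by simp
  right_inv y := by simp

/-- Regrouping of the block labels of the overlap: the factors `H_i^in` are split off the tensor
factors `Fin (k a i)` of all blocks. -/
def blockRegroup {r : ℕ} {l : Fin r → ℕ} {k dE0 : Fin r → Fin n → ℕ} {dIn : Fin n → ℕ}
    (e : ∀ a i, Fin (k a i) ≃ Fin (dE0 a i) × Fin (dIn i)) :
    (Σ a, Fin (l a) × ∀ i, Fin (k a i)) ≃
      (Σ a, Fin (l a) × ∀ i, Fin (dE0 a i)) × ∀ i, Fin (dIn i) where
  toFun t := (⟨t.1, t.2.1, fun i => (e t.1 i (t.2.2 i)).1⟩, fun i => (e t.1 i (t.2.2 i)).2)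
  invFun t := ⟨t.1.1, t.1.2.1, fun i => (e t.1.1 i).symm (t.1.2.2 i, t.2 i)⟩
  left_inv t := by simp
  right_inv t := by simp

/-- The block form of a 1-local operator on site `i` acts on the private region `i` and the overlap
only. Its slices on the overlap are block-diagonal, and act on the factor `i` of each block. -/
theorem Decomposition.directSum_block_onSite (D : Decomposition d d' S)
    {k : Fin D.r → Fin n → ℕ} (e : ∀ a i, Fin (k a i) ≃ Fin (D.dE0 a i) × Fin (D.dIn i))
    (eC : Cfg (fun k : overlap S => d' k) ≃ Σ a, Fin (D.dE00 a) × ∀ i, Fin (k a i))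
    (hov : ∀ x, D.overlapEquiv x = blockRegroup e (eC x))
    {U : ∀ a i, Matrix (D.Loc a i) (D.Loc a i) ℂ} (hU : ∀ a i, U a i * (U a i)ᴴ = 1)
    (i : Fin n) (A : Fin D.r → Matrix (Fin (d i)) (Fin (d i)) ℂ) :
    D.directSum (fun a => D.block a (U a) (onSite i (A a))) =
      (liftOp i (Matrix.of fun x y => Matrix.blockDiagonal' (fun a =>
        (1 : Matrix (Fin (D.dE00 a)) (Fin (D.dE00 a)) ℂ) ⊗ₖ localOp (κ := fun i => Fin (k a i)) i
          (slice ((U a i * (A a ⊗ₖ 1) * (U a i)ᴴ).submatrix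
            (D.locEquiv a i (e a i)) (D.locEquiv a i (e a i))) x.1 y.1))
        (eC x.2) (eC y.2))).submatrix (splitCfg S) (splitCfg S) := by
  have hB : ∀ a, D.block a (U a) (onSite i (A a)) =
      (1 : Matrix (Fin (D.dE00 a)) (Fin (D.dE00 a)) ℂ) ⊗ₖ
        (localOp (κ := D.Loc a) i (U a i * (A a ⊗ₖ 1) * (U a i)ᴴ) ⊗ₖ
          (1 : Op (fun k : outside S => d' k))) := fun a => by
    rw [block, ampl_onSite, tensorOp_conj_localOp (hU a)]
  simp only [hB]
  generalize hN : (fun a => U a i * (A a ⊗ₖ 1) * (U a i)ᴴ) = N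
  have hN' : ∀ a, U a i * (A a ⊗ₖ 1) * (U a i)ᴴ = N a := fun a => congrFun hN a
  simp only [hN']
  -- the label of the block obtained by regrouping, in terms of the blocks of the overlap
  let g : (Σ a, Fin (D.dE00 a) × ∀ i, Fin (k a i)) → (∀ i, Cfg fun k : priv S i => d' k) →
      (Cfg fun k : outside S => d' k) → Σ a, D.Blk a := fun t p o =>
    ⟨t.1, t.2.1, fun i => D.locEquiv t.1 i (e t.1 i) (p i, t.2.2 i), o⟩
  have hg : ∀ x, D.regroup x = g (eC (splitCfg S x).1) (splitCfg S x).2.1 (splitCfg S x).2.2 := by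
    intro x
    simp only [regroup]
    rw [hov]
    rfl
  ext x y
  rw [directSum, Matrix.submatrix_apply, Matrix.submatrix_apply, hg, hg, liftOp_apply,
    Matrix.of_apply]
  generalize splitCfg S x = x'
  generalize splitCfg S y = y'
  obtain ⟨c, p, o⟩ := x'
  obtain ⟨c', p', o'⟩ := y'
  simp only
  generalize eC c = t
  generalize eC c' = t'
  obtain ⟨a, s, z⟩ := t
  obtain ⟨a', s', z'⟩ := t'
  simp only [g]
  by_cases ha : a = a'
  · subst ha
    rw [Matrix.blockDiagonal'_apply_eq, Matrix.blockDiagonal'_apply_eq]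
    simp only [Matrix.kroneckerMap_apply, localOp_apply, slice_apply, Matrix.submatrix_apply,
      EmbeddingLike.apply_eq_iff_eq, Prod.mk.injEq, Matrix.one_apply]
    by_cases ho : o = o'
    · by_cases hp : ∀ j, j ≠ i → p j = p' j
      · by_cases hz : ∀ j, j ≠ i → z j = z' j
        · have h : ∀ j, j ≠ i → p j = p' j ∧ z j = z' j := fun j hj => ⟨hp j hj, hz j hj⟩
          rw [if_pos h, if_pos hz, if_pos ho,
            if_pos (c := (∀ j, j ≠ i → p j = p' j) ∧ o = o') ⟨hp, ho⟩, mul_one]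
        · rw [if_neg hz, if_neg (c := ∀ j, j ≠ i → p j = p' j ∧ z j = z' j)
            fun h => hz fun j hj => (h j hj).2]
          simp
      · rw [if_neg (c := (∀ j, j ≠ i → p j = p' j) ∧ o = o') fun h => hp h.1,
          if_neg (c := ∀ j, j ≠ i → p j = p' j ∧ z j = z' j) fun h => hp fun j hj => (h j hj).1]
        simp
    · simp [ho]
  · rw [Matrix.blockDiagonal'_apply_ne _ _ _ ha, Matrix.blockDiagonal'_apply_ne _ _ _ ha]
    simp

theorem submatrix_unitary {M N M' N' : Type*} [Fintype M] [DecidableEq M] [Fintype N]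
    [DecidableEq N] [Fintype M'] [DecidableEq M'] [Fintype N'] [DecidableEq N']
    {W : Matrix M N ℂ} (h : Wᴴ * W = 1) (e : M' ≃ M) (f : N' ≃ N) :
    (W.submatrix e f)ᴴ * W.submatrix e f = 1 := by
  rw [Matrix.conjTranspose_submatrix, Matrix.submatrix_mul_equiv, h, Matrix.submatrix_one_equiv]

/-- Dimensions for the factors of `H_i`, `H_{Q_i}` and the blocks of the overlap. The factor
`H_i^out` carries the common factor of the dimensions `d i` of `H_i` and `p i` of `H_{Q_i}`. -/
theorem exists_dimensions {n r : ℕ} {d : Fin n → ℕ} (hd : ∀ i, 0 < d i) (p : Fin n → ℕ)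
    (k m : Fin r → Fin n → ℕ) (h : ∀ a i, p i * k a i = d i * m a i) :
    ∃ (dIn dOut dE : Fin n → ℕ) (dE0 : Fin r → Fin n → ℕ), (∀ i, dIn i * dOut i = d i) ∧
      (∀ i, dE i * dOut i = p i) ∧ (∀ a i, dE0 a i * dIn i = k a i) ∧
      ∀ a i, m a i = dE i * dE0 a i := by
  have hdIn : ∀ i, d i / (d i).gcd (p i) * (d i).gcd (p i) = d i := fun i =>
    Nat.div_mul_cancel (Nat.gcd_dvd_left _ _)
  have hdE : ∀ i, p i / (d i).gcd (p i) * (d i).gcd (p i) = p i := fun i =>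
    Nat.div_mul_cancel (Nat.gcd_dvd_right _ _)
  have hdE0 : ∀ a i, k a i / (d i / (d i).gcd (p i)) * (d i / (d i).gcd (p i)) = k a i :=
    fun a i => Nat.div_mul_cancel (dvd_of_mul_eq_mul (hd i) (h a i))
  refine ⟨fun i => d i / (d i).gcd (p i), fun i => (d i).gcd (p i),
    fun i => p i / (d i).gcd (p i), fun a i => k a i / (d i / (d i).gcd (p i)),
    hdIn, hdE, hdE0, fun a i => Nat.eq_of_mul_eq_mul_left (hd i) ?_⟩
  calc d i * m a i = p i * k a i := (h a i).symm
    _ = (p i / (d i).gcd (p i) * (d i).gcd (p i)) *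
        (k a i / (d i / (d i).gcd (p i)) * (d i / (d i).gcd (p i))) := by rw [hdE, hdE0]
    _ = (d i / (d i).gcd (p i) * (d i).gcd (p i)) *
        (p i / (d i).gcd (p i) * (k a i / (d i / (d i).gcd (p i)))) := by ring
    _ = _ := by rw [hdIn]

theorem slice_mul_one_kronecker {P C : Type*} [Fintype P] [DecidableEq P] [Fintype C]
    (Z : Matrix (P × C) (P × C) ℂ) (V : Matrix C C ℂ) (u v : P) :
    slice (Z * ((1 : Matrix P P ℂ) ⊗ₖ V)) u v = slice Z u v * V := by
  ext x y
  simp [slice_apply, Matrix.mul_apply, Fintype.sum_prod_type, Matrix.one_apply]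

theorem slice_one_kronecker_mul {P C : Type*} [Fintype P] [DecidableEq P] [Fintype C]
    (Z : Matrix (P × C) (P × C) ℂ) (V : Matrix C C ℂ) (u v : P) :
    slice (((1 : Matrix P P ℂ) ⊗ₖ V) * Z) u v = V * slice Z u v := by
  ext x y
  simp [slice_apply, Matrix.mul_apply, Fintype.sum_prod_type, Matrix.one_apply]

/-- Labels of the overlap. -/
abbrev OverlapCfg (d' : Fin n' → ℕ) (S : Fin n → Finset (Fin n')) : Type :=
  Cfg fun k : overlap S => d' k

/-- Labels of the private region `i`. -/
abbrev PrivCfg (d' : Fin n' → ℕ) (S : Fin n → Finset (Fin n')) (i : Fin n) : Type :=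
  Cfg fun k : priv S i => d' k

/-- Labels of the outside region. -/
abbrev OutsideCfg (d' : Fin n' → ℕ) (S : Fin n → Finset (Fin n')) : Type :=
  Cfg fun k : outside S => d' k

/-- The images of the 1-local operators on site `i` under a local encoding, regarded as an encoding
on the private region `i` and the overlap. -/
theorem IsLocalEncoding.exists_regional (hd' : ∀ k, 0 < d' k) {E : Op d → Op d'}
    (hE : IsLocalEncoding S E) :
    ∃ Z : ∀ i, Matrix (Fin (d i)) (Fin (d i)) ℂ →
        Matrix (PrivCfg d' S i × OverlapCfg d' S) (PrivCfg d' S i × OverlapCfg d' S) ℂ,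
      (∀ i A, E (onSite i A) = (liftOp (O := OutsideCfg d' S) (P := PrivCfg d' S) i
        (Z i A)).submatrix (splitCfg S) (splitCfg S)) ∧
      (∀ i, IsEncoding (Z i)) ∧
      (∀ i j, i ≠ j → ∀ A B, Commute (liftOp (O := OutsideCfg d' S) (P := PrivCfg d' S) i (Z i A))
        (liftOp j (Z j B))) ∧
      ∀ i j, liftOp (O := OutsideCfg d' S) (P := PrivCfg d' S) i (Z i (Complex.I • 1)) =
        liftOp j (Z j (Complex.I • 1)) := by
  have : Nonempty (OutsideCfg d' S) := ⟨fun k => ⟨0, hd' k⟩⟩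
  have : ∀ i, Nonempty (PrivCfg d' S i) := fun i => ⟨fun k => ⟨0, hd' k⟩⟩
  choose Z hZ using fun i A => (hE.actsOnlyOn i A).exists_liftOp
  have hsub := isEncoding_submatrix (splitCfg_bijective (d' := d') (S := S))
  have hinj := submatrix_injective (splitCfg_bijective (d' := d') (S := S)).2
  refine ⟨Z, hZ, fun i => ?_, fun i j hij A B => hinj ?_, fun i j => hinj ?_⟩
  · refine (hsub.comp (isEncoding_liftOp (C := OverlapCfg d' S) (O := OutsideCfg d' S)
      (P := PrivCfg d' S) i)).of_comp (hinj.comp (liftOp_injective i)) ?_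
    have h : (fun A => ((fun A => A.submatrix (splitCfg S) (splitCfg S)) ∘
        liftOp (C := OverlapCfg d' S) (O := OutsideCfg d' S) (P := PrivCfg d' S) i) (Z i A)) =
          E ∘ localOp (κ := fun i => Fin (d i)) i := by
      ext1 A
      exact (hZ i A).symm
    rw [h]
    exact hE.isEncoding.comp (isEncoding_localOp (κ := fun i => Fin (d i)) i)
  · change Matrix.submatrix _ _ _ = Matrix.submatrix _ _ _
    rw [Matrix.submatrix_mul _ _ _ _ _ splitCfg_bijective,
      Matrix.submatrix_mul _ _ _ _ _ splitCfg_bijective, ← hZ, ← hZ,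
      ← hE.isEncoding.map_mul, ← hE.isEncoding.map_mul]
    congr 1
    exact localOp_commute (κ := fun i => Fin (d i)) hij A B
  · change Matrix.submatrix _ _ _ = Matrix.submatrix _ _ _
    rw [← hZ, ← hZ, onSite_eq_localOp, onSite_eq_localOp, localOp_smul, localOp_smul,
      localOp_one, localOp_one]

/-- Undoing a change of basis in the block form of an amplification. -/
theorem reindex_conj_kronecker_one {M N κ p q : Type*} [Fintype M] [Fintype N] [Fintype κ]
    [DecidableEq κ] [Fintype p] [DecidableEq p] [Fintype q] [DecidableEq q]
    (W : Matrix M (κ × p) ℂ) (lam : M ≃ N) (μ : q ≃ p) (A : Matrix κ κ ℂ) :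
    (W.submatrix lam.symm (Equiv.prodCongr (Equiv.refl κ) μ) * (A ⊗ₖ (1 : Matrix q q ℂ)) *
      (W.submatrix lam.symm (Equiv.prodCongr (Equiv.refl κ) μ))ᴴ).submatrix lam lam =
    W * (A ⊗ₖ (1 : Matrix p p ℂ)) * Wᴴ := by
  have h1 : A ⊗ₖ (1 : Matrix q q ℂ) = (A ⊗ₖ (1 : Matrix p p ℂ)).submatrix
      (Equiv.prodCongr (Equiv.refl κ) μ) (Equiv.prodCongr (Equiv.refl κ) μ) := by
    ext x y
    simp [Matrix.one_apply]
  rw [h1, Matrix.conjTranspose_submatrix, Matrix.submatrix_mul_equiv,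
    Matrix.submatrix_mul_equiv, Matrix.submatrix_submatrix]
  simp

/-- If `V` intertwines the slices of `Z` with those of `Z'`, it intertwines the operators themselves
on the whole simulator. -/
theorem liftOp_submatrix_mul_extendOp (i : Fin n)
    {Z Z' : Matrix (PrivCfg d' S i × OverlapCfg d' S) (PrivCfg d' S i × OverlapCfg d' S) ℂ}
    {V : Op fun k : overlap S => d' k}
    (h : ∀ u v, slice Z u v * V = V * slice Z' u v) :
    (liftOp (O := OutsideCfg d' S) (P := PrivCfg d' S) i Z).submatrix (splitCfg S) (splitCfg S) *
        extendOp (overlap S) V =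
      extendOp (overlap S) V * (liftOp (O := OutsideCfg d' S) (P := PrivCfg d' S) i Z').submatrix
        (splitCfg S) (splitCfg S) := by
  have hZ : Z * ((1 : Matrix (PrivCfg d' S i) (PrivCfg d' S i) ℂ) ⊗ₖ V) =
      ((1 : Matrix (PrivCfg d' S i) (PrivCfg d' S i) ℂ) ⊗ₖ V) * Z' := by
    refine ext_slice fun u v => ?_
    rw [slice_mul_one_kronecker, slice_one_kronecker_mul, h]
  rw [extendOp_overlap, ← liftOp_one_kronecker (P := PrivCfg d' S) (O := OutsideCfg d' S) i,
    ← Matrix.submatrix_mul _ _ _ _ _ splitCfg_bijective,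
    ← Matrix.submatrix_mul _ _ _ _ _ splitCfg_bijective,
    ← (isEncoding_liftOp (C := OverlapCfg d' S) (O := OutsideCfg d' S)
      (P := PrivCfg d' S) i).map_mul,
    ← (isEncoding_liftOp (C := OverlapCfg d' S) (O := OutsideCfg d' S)
      (P := PrivCfg d' S) i).map_mul, hZ]

/-- The block form of a 1-local operator, compared with an operator on the private region `i` and
the overlap: it suffices to compare the slices on the overlap. Here `N a` is the operator that acts
on the factor `i` of the block `a`. -/
theorem Decomposition.liftOp_mul_extendOp (D : Decomposition d d' S)
    {k : Fin D.r → Fin n → ℕ} (e : ∀ a i, Fin (k a i) ≃ Fin (D.dE0 a i) × Fin (D.dIn i))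
    (eC : OverlapCfg d' S ≃ Σ a, Fin (D.dE00 a) × ∀ i, Fin (k a i))
    (hov : ∀ x, D.overlapEquiv x = blockRegroup e (eC x))
    {U : ∀ a i, Matrix (D.Loc a i) (D.Loc a i) ℂ} (hU : ∀ a i, U a i * (U a i)ᴴ = 1)
    (i : Fin n) (A : Fin D.r → Matrix (Fin (d i)) (Fin (d i)) ℂ)
    (N : ∀ a, Matrix (PrivCfg d' S i × Fin (k a i)) (PrivCfg d' S i × Fin (k a i)) ℂ)
    (hN : ∀ a, (U a i * (A a ⊗ₖ (1 : Matrix (Fin (D.dE i) × Fin (D.dE0 a i))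
      (Fin (D.dE i) × Fin (D.dE0 a i)) ℂ)) * (U a i)ᴴ).submatrix
        (D.locEquiv a i (e a i)) (D.locEquiv a i (e a i)) = N a)
    {Z : Matrix (PrivCfg d' S i × OverlapCfg d' S) (PrivCfg d' S i × OverlapCfg d' S) ℂ}
    {V : Op fun k : overlap S => d' k}
    (h : ∀ u v, slice Z u v * V = V * (Matrix.blockDiagonal' fun a =>
      (1 : Matrix (Fin (D.dE00 a)) (Fin (D.dE00 a)) ℂ) ⊗ₖ
        localOp (κ := fun i => Fin (k a i)) i (slice (N a) u v)).submatrix eC eC) :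
    (liftOp (O := OutsideCfg d' S) (P := PrivCfg d' S) i Z).submatrix (splitCfg S) (splitCfg S) *
        extendOp (overlap S) V =
      extendOp (overlap S) V * D.directSum (fun a => D.block a (U a) (onSite i (A a))) := by
  rw [D.directSum_block_onSite e eC hov hU i A]
  refine liftOp_submatrix_mul_extendOp i fun u v => ?_
  rw [h]
  simp only [hN]
  rfl

/-- The block form of a local encoding, with the choice between `M` and its complex conjugate on the
block `α` recorded by `b α`. -/
theorem IsLocalEncoding.exists_decomposition (hn : 2 ≤ n) (hd : ∀ i, 0 < d i)
    (hd' : ∀ k, 0 < d' k) {E : Op d → Op d'} (hE : IsLocalEncoding S E) :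
    ∃ (D : Decomposition d d' S)
      (U₀ : Matrix.unitaryGroup (Cfg (fun k : overlap S => d' k)) ℂ)
      (U : ∀ (α : Fin D.r) (i : Fin n), Matrix.unitaryGroup (D.Loc α i) ℂ)
      (b : Fin D.r → Bool), ∀ M : Op d,
        E M = extendOp (overlap S) U₀.1 *
          D.directSum (fun α => D.block α (fun i => (U α i).1) (conjIf (b α) M)) *
          (extendOp (overlap S) U₀.1)ᴴ := by
  have : Nonempty (OutsideCfg d' S) := ⟨fun k => ⟨0, hd' k⟩⟩
  have : ∀ i, Nonempty (PrivCfg d' S i) := fun i => ⟨fun k => ⟨0, hd' k⟩⟩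
  obtain ⟨Z, hZ, hZE, hcomm, hI⟩ := hE.exists_regional hd'
  obtain ⟨r, l, k, F, b, m, W, hF, hW1, hW2, hact⟩ := exists_normal_form hn hd hZE hcomm hI
  have hcard : ∀ a i, Fintype.card (PrivCfg d' S i) * k a i = d i * m a i := fun a i => by
    simpa using card_eq_of_unitary (hW1 a i) (hW2 a i)
  obtain ⟨dIn, dOut, dE, dE0, hdIn, hdE, hdE0, hm⟩ :=
    exists_dimensions hd (fun i => Fintype.card (PrivCfg d' S i)) k m hcard
  obtain ⟨e⟩ : Nonempty (∀ a i, Fin (k a i) ≃ Fin (dE0 a i) × Fin (dIn i)) :=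
    ⟨fun a i => Fintype.equivOfCardEq (by simp [hdE0])⟩
  obtain ⟨μ⟩ : Nonempty (∀ a i, Fin (dE i) × Fin (dE0 a i) ≃ Fin (m a i)) :=
    ⟨fun a i => Fintype.equivOfCardEq (by simp [hm])⟩
  obtain ⟨eC⟩ : Nonempty (OverlapCfg d' S ≃ Σ a, Fin (l a) × ∀ i, Fin (k a i)) :=
    ⟨Fintype.equivOfCardEq (card_eq_of_unitary hF.join_isometry hF.join_coisometry)⟩
  obtain ⟨site⟩ : Nonempty (∀ i, Fin (d i) ≃ Fin (dIn i) × Fin (dOut i)) :=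
    ⟨fun i => Fintype.equivOfCardEq (by simp [hdIn])⟩
  obtain ⟨pe⟩ : Nonempty (∀ i, PrivCfg d' S i ≃ Fin (dE i) × Fin (dOut i)) :=
    ⟨fun i => Fintype.equivOfCardEq (by
      rw [Fintype.card_prod, Fintype.card_fin, Fintype.card_fin, hdE])⟩
  let D : Decomposition d d' S :=
    { r := r
      dIn := dIn
      dOut := dOut
      dE := dE
      dE00 := l
      dE0 := dE0
      site := site
      overlapEquiv := eC.trans (blockRegroup e)
      privEquiv := pe }
  let V : Op (fun k : overlap S => d' k) := (joinIsometries F).submatrix id eC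
  have hV : Vᴴ * V = 1 := submatrix_unitary hF.join_isometry (Equiv.refl _) eC
  let lam : ∀ a i, PrivCfg d' S i × Fin (k a i) ≃ D.Loc a i := fun a i => D.locEquiv a i (e a i)
  let U : ∀ a i, Matrix (D.Loc a i) (D.Loc a i) ℂ := fun a i =>
    (W a i).submatrix (lam a i).symm (Equiv.prodCongr (Equiv.refl _) (μ a i))
  have hU : ∀ a i, (U a i)ᴴ * U a i = 1 := fun a i => submatrix_unitary (hW1 a i) _ _
  have hU' : ∀ a i, U a i * (U a i)ᴴ = 1 := fun a i => mul_eq_one_comm.1 (hU a i)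
  refine ⟨D, ⟨V, Matrix.mem_unitaryGroup_iff'.2 hV⟩,
    fun a i => ⟨U a i, Matrix.mem_unitaryGroup_iff'.2 (hU a i)⟩, b, ?_⟩
  refine congrFun (IsEncoding.eq_of_onSite (by omega) (isEncoding_blockForm D hV hU b)
    hE.isEncoding fun i A => ?_)
  have hVV : extendOp (overlap S) V * (extendOp (overlap S) V)ᴴ = 1 := by
    rw [extendOp_conjTranspose, ← extendOp_mul, mul_eq_one_comm.1 hV, extendOp_one]
  have hconj : ∀ a, conjIf (b a) (onSite i A) = onSite i (conjIf (b a) A) := fun a =>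
    conjIf_localOp (κ := fun i => Fin (d i)) (b a) i A
  have key : E (onSite i A) * extendOp (overlap S) V = extendOp (overlap S) V *
      D.directSum (fun a => D.block a (U a) (conjIf (b a) (onSite i A))) := by
    simp only [hconj]
    rw [hZ]
    exact D.liftOp_mul_extendOp e eC (fun _ => rfl) hU' i (fun a => conjIf (b a) A)
      (fun a => W a i * (conjIf (b a) A ⊗ₖ (1 : Matrix (Fin (m a i)) (Fin (m a i)) ℂ)) * (W a i)ᴴ)
      (fun a => reindex_conj_kronecker_one (W a i) (lam a i) (μ a i) _)
      fun u v => mul_submatrix_of_mul_eq eC (mul_joinIsometries fun a => hact i A u v a)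
  change E (onSite i A) = extendOp (overlap S) V *
      D.directSum (fun a => D.block a (U a) (conjIf (b a) (onSite i A))) *
        (extendOp (overlap S) V)ᴴ
  rw [← key, Matrix.mul_assoc, hVV, Matrix.mul_one]

end Assemble

end LocalEnc

theorem mainTheorem7 {n n' : ℕ} (hn : 2 ≤ n) (d : Fin n → ℕ) (d' : Fin n' → ℕ)
    (hd : ∀ i, 0 < d i) (hd' : ∀ k, 0 < d' k) (S : Fin n → Finset (Fin n'))
    (E : LocalEnc.Op d → LocalEnc.Op d') (hE : LocalEnc.IsLocalEncoding S E) :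
    (∃ (D : LocalEnc.Decomposition d d' S)
        (U₀ : Matrix.unitaryGroup (LocalEnc.Cfg (fun k : LocalEnc.overlap S => d' k)) ℂ)
        (U : ∀ (α : Fin D.r) (i : Fin n), Matrix.unitaryGroup (D.Loc α i) ℂ)
        (σ : Fin D.r → LocalEnc.Op d → LocalEnc.Op d),
        (∀ α, σ α = id ∨ σ α = LocalEnc.conjOp) ∧
        ∀ M : LocalEnc.Op d,
          E M = LocalEnc.extendOp (LocalEnc.overlap S) U₀.1 *
              D.directSum (fun α => D.block α (fun i => (U α i).1) (σ α M)) *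
              (LocalEnc.extendOp (LocalEnc.overlap S) U₀.1).conjTranspose) ∧
    (∀ (T : Finset (Fin n)) (M : LocalEnc.Op d), T.Nonempty → LocalEnc.ActsOnlyOn T M →
        LocalEnc.ActsOnlyOn (T.biUnion S) (E M)) ∧
    (∀ E₂ : LocalEnc.Op d → LocalEnc.Op d', LocalEnc.IsEncoding E₂ →
        (∀ (i : Fin n) (A : Matrix (Fin (d i)) (Fin (d i)) ℂ),
          E₂ (LocalEnc.onSite i A) = E (LocalEnc.onSite i A)) → E₂ = E) := by
  refine ⟨?_, fun T M hT hM => hE.actsOnlyOn_biUnion hT hM, fun E₂ hE₂ h =>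
    LocalEnc.IsEncoding.eq_of_onSite (by omega) hE.isEncoding hE₂ h⟩
  obtain ⟨D, U₀, U, b, h⟩ := hE.exists_decomposition hn hd hd'
  refine ⟨D, U₀, U, fun α => LocalEnc.conjIf (b α), fun α => ?_, h⟩
  change LocalEnc.conjIf (b α) = id ∨ LocalEnc.conjIf (b α) = LocalEnc.conjOp
  cases b α
  · exact Or.inl (funext fun _ => rfl)
  · exact Or.inr (funext fun _ => rfl)
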